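/- **Setting.** Let $K,n\in\mathbb N$ with $n\ge 2$, let $\mathcal Z$ be a measurable space and let $\phi_i:\mathcal Z\to\mathbb R$, $i=1,2,\dots$, be measurable features satisfying, for some $\beta>1$, the polynomial decay condition $\|\phi_i\|_\infty\le i^{-\beta/2}$ for all $i$, or, for some $\beta>0$, the exponential decay condition $\|\phi_i\|_\infty\le \exp(-i^{\beta}/2)$ for all $i$. For a real sequence $w=(w_i)_{i\ge1}$, a context $x=(x_a)_{a\in[K]}\in\mathcal Z^K$ and $a\in[K]$, put $f_w(x,a)=\sum_{i\ge1}w_i\phi_i(x_a)$ and $f_w(x)=\max_{a\in[K]}f_w(x,a)$. Let $w^*$ be a sequence with finitely many non-zero entries, $\|w^*\|_0$ in number, and $\|w^*\|_1\le1$; let $f^*=f_{w^*}$. In each round $t=1,\dots,n$ a context $X_t$ is revealed (possibly chosen by an adaptive adversary), the learner plays $A_t\in[K]$ and observes $Y_t=f^*(X_t,A_t)+\epsilon_t$, where, conditionally on $\mathcal F_{t-1}=\sigma(X_1,A_1,Y_1,\dots,X_{t-1},A_{t-1},Y_{t-1})$, $X_t$ and $A_t$, the noise $\epsilon_t$ has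 mean zero and satisfies $\mathbb E[e^{\theta\epsilon_t}\mid\mathcal F_{t-1},X_t,A_t]\le e^{\theta^2/8}$ for all $\theta\in\mathbb R$. The regret is $R_n(f^*)=\mathbb E\big[\sum_{t=1}^n (f^*(X_t)-f^*(X_t,A_t))\big]$. **Algorithm.** Let $d_{\mathrm{eff}}=\min\{i\ge1:\ \|\phi_j\|_\infty^2\le 1/n\ \ \forall j>i\}$. The prior is $p_1=\sum_{M\subseteq[d_{\mathrm{eff}}]}p_1(M)\,\mathcal U(\mathcal W_M)$, where $p_1(\emptyset)=0$, $p_1(M)=2^{-|M|}\big/\big(\binom{d_{\mathrm{eff}}}{|M|}\sum_{m=1}^{d_{\mathrm{eff}}}2^{-m}\big)$ for non-empty $M\subseteq[d_{\mathrm{eff}}]$, and $\mathcal U(\mathcal W_M)$ is the uniform distribution on $\mathcal W_M=\{w:\|w\|_1\le1,\ w_i=0\ \forall i\notin M\}$. Feel-Good Thompson Sampling (FGTS) with parameters $\eta=1/4$ and $\lambda$ draws, in round $t$, conditionally on $\mathcal F_{t-1}$ and $X_t$, a parameter $w_t$ from the posterior $$p_t(\mathrm dw)\propto\exp\Big(-\sum_{l=1}^{t-1}\big[\eta(f_w(X_l,A_l)-Y_l)^2-\lambda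 f_w(X_l)\big]\Big)p_1(\mathrm dw)$$ and plays an action $A_t\in\arg\max_{a\in[K]}f_{w_t}(X_t,a)$, with any tie-breaking. **Theorem.** For all constants $0<c_1\le c_2$ there is a constant $C>0$, depending only on $c_1$ and $c_2$, such that in every such setting: 1. (Unknown sparsity.) If $c_1 g\le\lambda\le c_2 g$ with $g=\sqrt{\log(d_{\mathrm{eff}}n)/(Kn)}$, then FGTS satisfies $$R_n(f^*)\le C\,\|w^*\|_0\sqrt{Kn\log(d_{\mathrm{eff}}n)}.$$ 2. (Known bound on the sparsity.) If $s\ge\|w^*\|_0$ is an integer and $c_1 g_s\le\lambda\le c_2 g_s$ with $g_s=\sqrt{s\log(d_{\mathrm{eff}}n)/(Kn)}$, then FGTS satisfies $$R_n(f^*)\le C\sqrt{Ksn\log(d_{\mathrm{eff}}n)}.$$ Consequently $R_n(f^*)\le C\sqrt{\log n}\cdot\frac18\sqrt{Ksn}$ under polynomial decay with any exponent $\beta>1$, and $R_n(f^*)\le C\sqrt{\log n}\cdot\frac18\sqrt{\max(1,1/\beta)Ksn}$ under exponential decay with exponent $\beta>0$; that is, the bound exceeds the expressions $\frac18\sqrt{Ksn}$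 and $\frac18\sqrt{\max(1,1/\beta)Ksn}$ of the minimax lower bounds for countable sparsity by at most a factor of order $\sqrt{\log n}$. -/

import Mathlib

open MeasureTheory

/-!
Sparse nonparametric contextual bandits with countable sparsity, and Feel-Good Thompson Sampling.

Indexing conventions. Features and weights are indexed by `ℕ` starting at `0`, so that `φ i` and
`w i` are the feature and the weight with (one-based) number `i + 1`, and the set `[d] = {1, …, d}`
of feature numbers is `Finset.range d`. Likewise, rounds are numbered `0, …, n - 1`.
A context is a family `x : Fin K → Z`, where `x a` is the element of `Z` attached to the action `a`.
-/
namespace SparseBandit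

noncomputable section

variable {Ω Z : Type*} {K : ℕ}

/-! ### Features and parameter sequences -/

/-- Polynomial decay with exponent `β > 1`: the sup norm of feature number `i + 1` is at most
`(i + 1) ^ (-β / 2)`. -/
def PolynomialDecay (β : ℝ) (φ : ℕ → Z → ℝ) : Prop :=
  1 < β ∧ ∀ i z, |φ i z| ≤ ((i : ℝ) + 1) ^ (-β / 2)

/-- Exponential decay with exponent `β > 0`: the sup norm of feature number `i + 1` is at most
`exp (-(i + 1) ^ β / 2)`. -/
def ExponentialDecay (β : ℝ) (φ : ℕ → Z → ℝ) : Prop :=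
  0 < β ∧ ∀ i z, |φ i z| ≤ Real.exp (-((i : ℝ) + 1) ^ β / 2)

/-- The effective dimension at sample size `n`: the least positive integer `d` such that every
feature with (one-based) number larger than `d` has squared sup norm at most `1 / n`. -/
def effDim (φ : ℕ → Z → ℝ) (n : ℕ) : ℕ :=
  sInf {d : ℕ | 1 ≤ d ∧ ∀ j, d ≤ j → ∀ z, (φ j z) ^ 2 ≤ 1 / (n : ℝ)}

/-- The function `f_w(z) = ∑ i, w i * φ i z`. The expected reward of action `a` in context `x` is
`linFun φ w (x a)`. -/
def linFun (φ : ℕ → Z → ℝ) (w : ℕ → ℝ) (z : Z) : ℝ := ∑' i, w i * φ i z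

/-- `f_w(x) = max_a f_w(x, a)`. -/
def maxReward (φ : ℕ → Z → ℝ) (w : ℕ → ℝ) (x : Fin K → Z) : ℝ := ⨆ a, linFun φ w (x a)

/-- The number of nonzero weights (meaningful for finitely supported sequences). -/
def l0norm (w : ℕ → ℝ) : ℕ := (Function.support w).ncard

/-! ### The subset-selection prior -/

/-- The prior probability of the support `M`: proportional to `2 ^ (-|M|) / (d choose |M|)` on the
non-empty subsets of the first `d` features. -/
def supportProb (d : ℕ) (M : Finset ℕ) : ℝ :=
  if M.Nonempty ∧ M ⊆ Finset.range d then
    (2⁻¹ : ℝ) ^ M.card / ((d.choose M.card : ℝ) * ∑ m ∈ Finset.Icc 1 d, (2⁻¹ : ℝ) ^ m)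
  else 0

/-- Extension of a weight vector indexed by `M` by zero to a sequence. -/
def extendZero (M : Finset ℕ) (v : M → ℝ) (i : ℕ) : ℝ := if h : i ∈ M then v ⟨i, h⟩ else 0

/-- The unit `ℓ¹` ball of `ℝ ^ M`. -/
def l1Ball (M : Finset ℕ) : Set (M → ℝ) := {v | ∑ i, |v i| ≤ 1}

/-- The uniform distribution on the sequences that vanish outside `M` and have `ℓ¹` norm
at most `1`. -/
def uniformOnBall (M : Finset ℕ) : Measure (ℕ → ℝ) :=
  (ProbabilityTheory.cond volume (l1Ball M)).map (extendZero M)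

/-- The subset-selection prior on parameter sequences, truncated to the first `d` features. -/
def sparsityPrior (d : ℕ) : Measure (ℕ → ℝ) :=
  ∑ M ∈ (Finset.range d).powerset, ENNReal.ofReal (supportProb d M) • uniformOnBall M

/-! ### Feel-Good Thompson Sampling -/

/-- The Feel-Good negative log-likelihood. -/
def fgLoss (η lam : ℝ) (φ : ℕ → Z → ℝ) (w : ℕ → ℝ) (x : Fin K → Z) (a : Fin K) (y : ℝ) : ℝ :=
  η * (linFun φ w (x a) - y) ^ 2 - lam * maxReward φ w x

/-- The posterior used in round `t`, given the contexts, actions and rewards of the rounds before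
`t`: the probability measure proportional to `exp (-∑ l < t, loss l) · p₁`. -/
def posterior (p₁ : Measure (ℕ → ℝ)) (η lam : ℝ) (φ : ℕ → Z → ℝ)
    (x : ℕ → Fin K → Z) (a : ℕ → Fin K) (y : ℕ → ℝ) (t : ℕ) : Measure (ℕ → ℝ) :=
  p₁.tilted fun w => -∑ l ∈ Finset.range t, fgLoss η lam φ w (x l) (a l) (y l)

/-! ### The interaction protocol -/

/-- The σ-algebra generated by the contexts, actions and rewards of the rounds before `t`. -/
abbrev historyAlg [MeasurableSpace Z] (X : ℕ → Ω → Fin K → Z) (A : ℕ → Ω → Fin K) (Y : ℕ → Ω → ℝ)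
    (t : ℕ) : MeasurableSpace Ω :=
  ⨆ l ∈ Finset.range t, (MeasurableSpace.comap (X l) inferInstance ⊔
    MeasurableSpace.comap (A l) inferInstance ⊔ MeasurableSpace.comap (Y l) inferInstance)

/-- The history before round `t` together with the context of round `t`. -/
abbrev preActionAlg [MeasurableSpace Z] (X : ℕ → Ω → Fin K → Z) (A : ℕ → Ω → Fin K) (Y : ℕ → Ω → ℝ)
    (t : ℕ) : MeasurableSpace Ω :=
  historyAlg X A Y t ⊔ MeasurableSpace.comap (X t) inferInstance

/-- The history before round `t` together with the context and the action of round `t`. -/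
abbrev preRewardAlg [MeasurableSpace Z] (X : ℕ → Ω → Fin K → Z) (A : ℕ → Ω → Fin K) (Y : ℕ → Ω → ℝ)
    (t : ℕ) : MeasurableSpace Ω :=
  preActionAlg X A Y t ⊔ MeasurableSpace.comap (A t) inferInstance

/-- The noise `ε_t = Y_t - f*(X_t, A_t)` of round `t`, where `f*` has parameter `wStar`. -/
def noise (φ : ℕ → Z → ℝ) (wStar : ℕ → ℝ) (X : ℕ → Ω → Fin K → Z) (A : ℕ → Ω → Fin K)
    (Y : ℕ → Ω → ℝ) (t : ℕ) (ω : Ω) : ℝ :=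
  Y t ω - linFun φ wStar (X t ω (A t ω))

/-- `n` rounds of a contextual bandit with reward function `f_{wStar}`. The contexts are arbitrary
random variables (so an adaptive adversary may choose them); the noise is, conditionally on the
history, the current context and the current action, centred and `1/2`-sub-Gaussian. -/
structure IsBanditInteraction [MeasurableSpace Ω] [MeasurableSpace Z] (P : Measure Ω)
    (φ : ℕ → Z → ℝ) (wStar : ℕ → ℝ) (n : ℕ)
    (X : ℕ → Ω → Fin K → Z) (A : ℕ → Ω → Fin K) (Y : ℕ → Ω → ℝ) : Prop where
  measurable_context : ∀ t < n, Measurable (X t)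
  measurable_action : ∀ t < n, Measurable (A t)
  measurable_reward : ∀ t < n, Measurable (Y t)
  noise_centred : ∀ t < n, P[noise φ wStar X A Y t | preRewardAlg X A Y t] =ᵐ[P] 0
  noise_exp_integrable : ∀ t < n, ∀ θ : ℝ,
    Integrable (fun ω => Real.exp (θ * noise φ wStar X A Y t ω)) P
  noise_subGaussian : ∀ t < n, ∀ θ : ℝ,
    P[fun ω => Real.exp (θ * noise φ wStar X A Y t ω) | preRewardAlg X A Y t]
      ≤ᵐ[P] fun _ => Real.exp (θ ^ 2 / 8)

/-- The actions are those of Feel-Good Thompson Sampling with prior `p₁` and parameters `η`, `lam`: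
in each round `t`, a parameter `ν t` is drawn from the posterior (that is, the posterior is its
conditional distribution given the history and the current context), and an action that maximises
`f_{ν t}(X_t, ·)` is played (ties may be broken in any way). -/
structure IsFGTS [MeasurableSpace Ω] [MeasurableSpace Z] (P : Measure Ω)
    (p₁ : Measure (ℕ → ℝ)) (η lam : ℝ) (φ : ℕ → Z → ℝ) (n : ℕ)
    (X : ℕ → Ω → Fin K → Z) (A : ℕ → Ω → Fin K) (Y : ℕ → Ω → ℝ) (ν : ℕ → Ω → ℕ → ℝ) : Prop where
  measurable_sample : ∀ t < n, Measurable (ν t)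
  sample_law : ∀ t < n, ∀ B : Set (ℕ → ℝ), MeasurableSet B →
    P[(ν t ⁻¹' B).indicator (fun _ => (1 : ℝ)) | preActionAlg X A Y t] =ᵐ[P]
      fun ω => (posterior p₁ η lam φ (fun l => X l ω) (fun l => A l ω) (fun l => Y l ω) t).real B
  action_greedy : ∀ t < n, ∀ ω, ∀ b : Fin K,
    linFun φ (ν t ω) (X t ω b) ≤ linFun φ (ν t ω) (X t ω (A t ω))

/-- The expected cumulative regret over `n` rounds for the reward function `f_{wStar}`. -/
def regret [MeasurableSpace Ω] (P : Measure Ω) (φ : ℕ → Z → ℝ) (wStar : ℕ → ℝ) (n : ℕ)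
    (X : ℕ → Ω → Fin K → Z) (A : ℕ → Ω → Fin K) : ℝ :=
  ∫ ω, ∑ t ∈ Finset.range n,
    (maxReward φ wStar (X t ω) - linFun φ wStar (X t ω (A t ω))) ∂P

end

end SparseBandit

open SparseBandit

/-!
The proof compares two consecutive partition functions of the posterior. Let `Z t` be the prior mean
of `exp (-cumulative excess loss)` after `t` rounds, the losses being measured relative to the true
reward function. The excess loss of a parameter `w` is `g² / 4 - g ε / 2 - lam F`, where `g` is the
reward gap of `w` at the action played, `ε` is the noise and `F` is the gap between the maximal
rewards. Taking the expectation over the sub-Gaussian noise gives, for `lam ≤ 1 / 2`,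
`E [Z (t + 1) / Z t] ≤ 1 - c E g² + lam E F + O(lam²)`, with `w` drawn from the posterior
independently of the action (`integrable_and_integral_likelihood_ratio_le`).

The regret of a round is `E [g - F]` at the parameter that was actually sampled, since the action is
greedy for it. The decoupling inequality `integral_action_gap_le`, an AM-GM inequality for each
action weighted by its conditional probability, bounds the first part by
`K / (4 μ) + μ E g²`, again with an independent `w`. With `lam μ = c` the terms in `g²` and in `F`
cancel, and `lam` times the regret of the round is at most `O(lam² K) + 1 - E [Z (t + 1) / Z t]`
(`round_regret_le`). As `1 - r ≤ -log r`, these terms telescope to `-log (Z n)`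
(`lam_mul_regret_le`).

It remains to bound `Z n` from below (`lam_mul_regret_le_of_sparse`). Let `m` be the size of a
support that carries the first `d` coordinates of the true parameter. The prior gives mass at least
`(2 d n)⁻ᵐ` to an `ℓ¹` neighbourhood of radius `2 / n` of the truncated parameter
(`pow_le_sparsityPrior`), by a homothety argument. On this neighbourhood the gap `g` is at most
`3 / √n` by the definition of the effective dimension, and only the truncation error, which does not
depend on `w` and therefore meets centred noise, has the order `1 / √n`. Hence
`-log (Z n) ≤ 2 m log (d n)` up to a constant, a term of order `lam √n` and terms with bounded
mean. Dividing by `lam` and inserting its value gives both regret bounds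
(`regret_le_of_tuned_parameter`); the comparison with the lower bounds is the estimate of
`log (d n)` by a multiple of `log n` under either decay condition.
-/

/-! ### Sub-Gaussian noise with a predictable exponent -/

open Filter Topology in
/-- A conditional sub-Gaussian bound, assumed for each fixed exponent `θ`, extends to exponents `θ`
that are measurable for the conditioning σ-algebra `m`, with a weight `b`. For a countably valued
`θ` this is the assumption on each level set; in general `θ` is rounded down to multiples of
`1 / (k + 1)` and Fatou's lemma is applied. -/
theorem lintegral_mul_exp_le_of_condExp_le {Ω : Type*} {m mΩ : MeasurableSpace Ω} (hm : m ≤ mΩ)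
    {P : Measure Ω} [IsProbabilityMeasure P] {ε : Ω → ℝ} (hε : Measurable ε)
    (hint : ∀ θ : ℝ, Integrable (fun ω => Real.exp (θ * ε ω)) P)
    (hsg : ∀ θ : ℝ, P[fun ω => Real.exp (θ * ε ω) | m] ≤ᵐ[P] fun _ => Real.exp (θ ^ 2 / 8))
    {θ b : Ω → ℝ} (hθ : Measurable[m] θ) (hb : Measurable[m] b) (hb0 : ∀ ω, 0 ≤ b ω)
    {T : ℝ} (hT : ∀ ω, |θ ω| ≤ T) :
    ∫⁻ ω, ENNReal.ofReal (b ω * Real.exp (θ ω * ε ω)) ∂P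
      ≤ ∫⁻ ω, ENNReal.ofReal (b ω * Real.exp (θ ω ^ 2 / 8)) ∂P := by
  have hset : ∀ (c : ℝ) (S : Set Ω), MeasurableSet[m] S →
      ∫⁻ ω in S, ENNReal.ofReal (Real.exp (c * ε ω)) ∂P
        ≤ ∫⁻ ω in S, ENNReal.ofReal (Real.exp (c ^ 2 / 8)) ∂P := by
    intro c S hS
    rw [← ofReal_integral_eq_lintegral_ofReal (hint c).integrableOn
      (Eventually.of_forall fun ω => (Real.exp_pos _).le),
      ← ofReal_integral_eq_lintegral_ofReal (integrable_const _)
      (Eventually.of_forall fun ω => (Real.exp_pos _).le)]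
    apply ENNReal.ofReal_le_ofReal
    rw [← setIntegral_condExp hm (hint c) hS]
    exact integral_mono_ae integrable_condExp.integrableOn (integrable_const _)
      (ae_restrict_of_ae (hsg c))
  have hmul : ∀ (c : ℝ) (g : Ω → ENNReal), Measurable[m] g →
      ∫⁻ ω, ENNReal.ofReal (Real.exp (c * ε ω)) * g ω ∂P
        ≤ ∫⁻ ω, ENNReal.ofReal (Real.exp (c ^ 2 / 8)) * g ω ∂P := by
    intro c g hg
    have h1 : Measurable fun ω => ENNReal.ofReal (Real.exp (c * ε ω)) := by fun_prop
    rw [← Pi.mul_def, ← Pi.mul_def,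
      ← lintegral_withDensity_eq_lintegral_mul P h1 (hg.mono hm le_rfl),
      ← lintegral_withDensity_eq_lintegral_mul P measurable_const (hg.mono hm le_rfl),
      ← lintegral_trim hm hg, ← lintegral_trim hm hg]
    refine lintegral_mono' ?_ le_rfl
    refine @Measure.le_intro Ω m _ _ fun S hS _ => ?_
    rw [trim_measurableSet_eq hm hS, trim_measurableSet_eq hm hS, withDensity_apply _ (hm _ hS),
      withDensity_apply _ (hm _ hS)]
    exact hset c S hS
  have hT0 : ∀ ω, 0 ≤ T := fun ω => (abs_nonneg _).trans (hT ω)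
  -- the discretisation of `θ` at scale `1 / (k + 1)` takes countably many values
  let D : ℕ → Ω → ℝ := fun k ω => (⌊((k : ℝ) + 1) * θ ω⌋ : ℝ) / ((k : ℝ) + 1)
  have hD : ∀ (k : ℕ) (ω : Ω), θ ω - 1 / ((k : ℝ) + 1) ≤ D k ω ∧ D k ω ≤ θ ω := by
    intro k ω
    have hk : (0 : ℝ) < (k : ℝ) + 1 := by positivity
    constructor
    · simp only [D]
      rw [le_div_iff₀ hk, sub_mul, one_div, inv_mul_cancel₀ hk.ne']
      linarith [Int.lt_floor_add_one (((k : ℝ) + 1) * θ ω)]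
    · simp only [D]
      rw [div_le_iff₀ hk, mul_comm]
      exact Int.floor_le _
  have hfl : ∀ k : ℕ, Measurable[m] fun ω => ⌊((k : ℝ) + 1) * θ ω⌋ := fun k =>
    Int.measurable_floor.comp ((measurable_const_mul _).comp hθ)
  have hDmeas : ∀ k, Measurable[m] (D k) := fun k =>
    (measurable_from_top (f := fun j : ℤ => (j : ℝ) / ((k : ℝ) + 1))).comp (hfl k)
  have hDint : ∀ k, ∫⁻ ω, ENNReal.ofReal (b ω * Real.exp (D k ω * ε ω)) ∂P
      ≤ ∫⁻ ω, ENNReal.ofReal (b ω * Real.exp (D k ω ^ 2 / 8)) ∂P := by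
    intro k
    let S : ℤ → Set Ω := fun j => (fun ω => ⌊((k : ℝ) + 1) * θ ω⌋) ⁻¹' {j}
    have hS : ∀ j, MeasurableSet[m] (S j) := fun j =>
      hfl k (measurableSet_singleton j)
    have hU : (⋃ j, S j) = Set.univ := by
      ext ω; simp [S]
    have hdisj : Pairwise (Function.onFun Disjoint S) := by
      intro i j hij
      refine Set.disjoint_left.2 fun ω h1 h2 => hij ?_
      simp only [S, Set.mem_preimage, Set.mem_singleton_iff] at h1 h2
      rw [← h1, ← h2]
    rw [← setLIntegral_univ,
      ← setLIntegral_univ (fun ω => ENNReal.ofReal (b ω * Real.exp (D k ω ^ 2 / 8))),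
      ← hU, lintegral_iUnion (fun j => hm _ (hS j)) hdisj,
      lintegral_iUnion (fun j => hm _ (hS j)) hdisj]
    refine ENNReal.tsum_le_tsum fun j => ?_
    have key := hmul ((j : ℝ) / ((k : ℝ) + 1)) ((S j).indicator fun ω => ENNReal.ofReal (b ω))
      (Measurable.indicator (ENNReal.measurable_ofReal.comp hb) (hS j))
    rw [← lintegral_indicator (hm _ (hS j)), ← lintegral_indicator (hm _ (hS j))]
    refine le_trans (le_of_eq ?_) (key.trans (le_of_eq ?_))
    all_goals
      refine lintegral_congr fun ω => ?_
      by_cases h : ω ∈ S j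
      · have h' : D k ω = (j : ℝ) / ((k : ℝ) + 1) := by
          have : ⌊((k : ℝ) + 1) * θ ω⌋ = j := h
          simp only [D, this]
        simp only [Set.indicator_of_mem h, h']
        rw [mul_comm (b ω), ENNReal.ofReal_mul (Real.exp_pos _).le]
      · simp [Set.indicator_of_notMem h]
  have hDlim : ∀ ω, Tendsto (fun k => D k ω) atTop (𝓝 (θ ω)) := by
    intro ω
    have h1 : Tendsto (fun k : ℕ => θ ω - 1 / ((k : ℝ) + 1)) atTop (𝓝 (θ ω)) := by
      simpa using tendsto_const_nhds.sub (tendsto_one_div_add_atTop_nhds_zero_nat (𝕜 := ℝ))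
    exact tendsto_of_tendsto_of_tendsto_of_le_of_le h1 tendsto_const_nhds
      (fun k => (hD k ω).1) (fun k => (hD k ω).2)
  -- `D k ω ^ 2 ≤ θ ω ^ 2 + 8 * r k`, so rounding costs a factor `exp (r k)` that tends to `1`
  let r : ℕ → ℝ := fun k => (2 * T * (1 / ((k : ℝ) + 1)) + (1 / ((k : ℝ) + 1)) ^ 2) / 8
  have hr : Tendsto (fun k => ENNReal.ofReal (Real.exp (r k))) atTop (𝓝 1) := by
    have h0 := tendsto_one_div_add_atTop_nhds_zero_nat (𝕜 := ℝ)
    have h1 : Tendsto r atTop (𝓝 ((2 * T * 0 + 0 ^ 2) / 8)) :=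
      ((h0.const_mul _).add (h0.pow 2)).div_const _
    have h2 := ENNReal.tendsto_ofReal ((Real.continuous_exp.tendsto _).comp h1)
    simpa using h2
  set I := ∫⁻ ω, ENNReal.ofReal (b ω * Real.exp (θ ω ^ 2 / 8)) ∂P with hI
  have hbound : ∀ k, ∫⁻ ω, ENNReal.ofReal (b ω * Real.exp (D k ω * ε ω)) ∂P
      ≤ ENNReal.ofReal (Real.exp (r k)) * I := by
    intro k
    refine (hDint k).trans ?_
    rw [hI, ← lintegral_const_mul' _ _ ENNReal.ofReal_ne_top]
    refine lintegral_mono fun ω => ?_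
    rw [← ENNReal.ofReal_mul (Real.exp_pos _).le]
    apply ENNReal.ofReal_le_ofReal
    rw [mul_left_comm, ← Real.exp_add]
    refine mul_le_mul_of_nonneg_left (Real.exp_le_exp.2 ?_) (hb0 ω)
    obtain ⟨h1, h2⟩ := hD k ω
    have h3 := abs_le.1 (hT ω)
    have h4 : 0 ≤ 1 / ((k : ℝ) + 1) := by positivity
    simp only [r]
    nlinarith [mul_nonneg h4 (hT0 ω), mul_nonneg (sub_nonneg.2 h2) (sub_nonneg.2 h1),
      mul_nonneg (sub_nonneg.2 h3.1) (sub_nonneg.2 h2)]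
  calc ∫⁻ ω, ENNReal.ofReal (b ω * Real.exp (θ ω * ε ω)) ∂P
      = ∫⁻ ω, liminf (fun k => ENNReal.ofReal (b ω * Real.exp (D k ω * ε ω))) atTop ∂P := by
        refine lintegral_congr fun ω => ((ENNReal.tendsto_ofReal ?_).liminf_eq).symm
        exact ((Real.continuous_exp.tendsto _).comp ((hDlim ω).mul_const _)).const_mul _
    _ ≤ liminf (fun k => ∫⁻ ω, ENNReal.ofReal (b ω * Real.exp (D k ω * ε ω)) ∂P) atTop := by
        refine lintegral_liminf_le fun k => ?_
        have h1 := (hDmeas k).mono hm le_rfl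
        have h2 := hb.mono hm le_rfl
        fun_prop
    _ ≤ liminf (fun k => ENNReal.ofReal (Real.exp (r k)) * I) atTop :=
        liminf_le_liminf (Eventually.of_forall hbound)
    _ = I := by
        have := ENNReal.Tendsto.mul_const (b := I) hr (Or.inl one_ne_zero)
        rw [one_mul] at this
        exact this.liminf_eq

/-! ### Conditional laws given by densities -/

/-- If `q (π ω)` is the density with respect to `p₁` of the conditional law of `ν` given `π`, a
condition that is stated on rectangles, then it determines the joint law of `π` and `ν`. -/
theorem map_prodMk_eq_withDensity {Ω Ω' W : Type*} [MeasurableSpace Ω] [MeasurableSpace Ω']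
    [MeasurableSpace W] {P : Measure Ω} [IsProbabilityMeasure P] {p₁ : Measure W}
    [IsProbabilityMeasure p₁] {π : Ω → Ω'} (hπ : Measurable π) {ν : Ω → W} (hν : Measurable ν)
    {q : Ω' → W → ℝ} (hq : Measurable (Function.uncurry q))
    (hrect : ∀ S B, MeasurableSet S → MeasurableSet B →
      P (π ⁻¹' S ∩ ν ⁻¹' B)
        = ∫⁻ ω in π ⁻¹' S, ∫⁻ w in B, ENNReal.ofReal (q (π ω) w) ∂p₁ ∂P) :
    P.map (fun ω => (π ω, ν ω))
      = ((P.map π).prod p₁).withDensity fun z => ENNReal.ofReal (q z.1 z.2) := by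
  have : IsProbabilityMeasure (P.map π) := Measure.isProbabilityMeasure_map hπ.aemeasurable
  have : IsFiniteMeasure (P.map (fun ω => (π ω, ν ω))) := inferInstance
  have hq' : Measurable fun z : Ω' × W => ENNReal.ofReal (q z.1 z.2) :=
    ENNReal.measurable_ofReal.comp hq
  refine Measure.ext_prod fun {S B} hS hB => ?_
  rw [Measure.map_apply (hπ.prodMk hν) (hS.prod hB), withDensity_apply _ (hS.prod hB),
    ← Measure.prod_restrict, lintegral_prod _ hq'.aemeasurable,
    setLIntegral_map hS (Measurable.lintegral_prod_right' hq') hπ, ← hrect S B hS hB]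
  rfl

/-- Disintegration: to average a function of the history `π` and of a posterior sample `ν`, one may
average over the posterior density `q (π ω)` first. -/
theorem integral_comp_eq_integral_integral_density {Ω Ω' W : Type*} [MeasurableSpace Ω]
    [MeasurableSpace Ω'] [MeasurableSpace W] {P : Measure Ω} [IsProbabilityMeasure P]
    {p₁ : Measure W} [IsProbabilityMeasure p₁] {π : Ω → Ω'} (hπ : Measurable π) {ν : Ω → W}
    (hν : Measurable ν) {q : Ω' → W → ℝ} (hq : Measurable (Function.uncurry q))
    (hq0 : ∀ o w, 0 ≤ q o w)
    (hrect : ∀ S B, MeasurableSet S → MeasurableSet B →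
      P (π ⁻¹' S ∩ ν ⁻¹' B)
        = ∫⁻ ω in π ⁻¹' S, ∫⁻ w in B, ENNReal.ofReal (q (π ω) w) ∂p₁ ∂P)
    {h : Ω' → W → ℝ} (hh : Measurable (Function.uncurry h)) {c : ℝ} (hc : ∀ o w, |h o w| ≤ c) :
    ∫ ω, h (π ω) (ν ω) ∂P = ∫ ω, ∫ w, q (π ω) w * h (π ω) w ∂p₁ ∂P := by
  have : IsProbabilityMeasure (P.map π) := Measure.isProbabilityMeasure_map hπ.aemeasurable
  have hmap := map_prodMk_eq_withDensity hπ hν hq hrect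
  have hq' : Measurable fun z : Ω' × W => ENNReal.ofReal (q z.1 z.2) :=
    ENNReal.measurable_ofReal.comp hq
  have hint : Integrable (Function.uncurry h) (P.map (fun ω => (π ω, ν ω))) :=
    Integrable.of_bound hh.aestronglyMeasurable c (Filter.Eventually.of_forall fun z => hc z.1 z.2)
  have e1 : ∫ ω, h (π ω) (ν ω) ∂P
      = ∫ z, Function.uncurry h z ∂(P.map (fun ω => (π ω, ν ω))) :=
    (integral_map (hπ.prodMk hν).aemeasurable hh.aestronglyMeasurable).symm
  rw [hmap, integrable_withDensity_iff_integrable_smul' hq'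
    (Filter.Eventually.of_forall fun _ => ENNReal.ofReal_lt_top)] at hint
  rw [e1, hmap, integral_withDensity_eq_integral_toReal_smul hq'
    (Filter.Eventually.of_forall fun _ => ENNReal.ofReal_lt_top), integral_prod _ hint,
    integral_map hπ.aemeasurable]
  · refine integral_congr_ae (Filter.Eventually.of_forall fun ω => ?_)
    refine integral_congr_ae (Filter.Eventually.of_forall fun w => ?_)
    simp [ENNReal.toReal_ofReal (hq0 _ _), Function.uncurry]
  · refine (StronglyMeasurable.integral_prod_right (f := fun o w =>
      (ENNReal.ofReal (q o w)).toReal • h o w) ?_).aestronglyMeasurable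
    exact (hq'.ennreal_toReal.smul hh).stronglyMeasurable

/-- A version of the conditional probability of `E` given `π` as a function on the target of `π`,
characterised by its action on bounded functions. The target carries no topology, so it is obtained
as the conditional distribution of the Boolean indicator of `E`. -/
theorem exists_condProb {Ω Ω' : Type*} [MeasurableSpace Ω] [MeasurableSpace Ω'] {P : Measure Ω}
    [IsProbabilityMeasure P] {π : Ω → Ω'} (hπ : Measurable π) {E : Set Ω} (hE : MeasurableSet E) :
    ∃ p : Ω' → ℝ, Measurable p ∧ (∀ o, 0 ≤ p o ∧ p o ≤ 1) ∧
      ∀ g : Ω' → ℝ, Measurable g → (∃ c, ∀ o, |g o| ≤ c) →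
        ∫ ω, E.indicator (fun ω => g (π ω)) ω ∂P = ∫ ω, p (π ω) * g (π ω) ∂P := by
  classical
  let U : Ω → Bool := fun ω => decide (ω ∈ E)
  have hU : Measurable U := measurable_to_bool (by
    have : U ⁻¹' {true} = E := by ext ω; simp [U]
    rwa [this])
  let κ := ProbabilityTheory.condDistrib U π P
  have hp : Measurable fun o => (κ o).real {true} :=
    (ProbabilityTheory.Kernel.measurable_coe κ (measurableSet_singleton _)).ennreal_toReal
  refine ⟨fun o => (κ o).real {true}, hp, fun o => ⟨measureReal_nonneg, measureReal_le_one⟩, ?_⟩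
  rintro g hg ⟨c, hc⟩
  have hf : Measurable fun z : Ω' × Bool => (if z.2 = true then g z.1 else 0) :=
    Measurable.ite (measurable_snd (measurableSet_singleton true)) (hg.comp measurable_fst)
      measurable_const
  have hint : Integrable (fun z : Ω' × Bool => (if z.2 = true then g z.1 else 0))
      (P.map (fun ω => (π ω, U ω))) := by
    refine Integrable.of_bound hf.aestronglyMeasurable c (Filter.Eventually.of_forall fun z => ?_)
    by_cases hz : z.2 = true
    · simpa [hz] using hc z.1
    · simpa [hz] using (abs_nonneg _).trans (hc z.1)
  have e1 : ∫ ω, E.indicator (fun ω => g (π ω)) ω ∂P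
      = ∫ z, (if z.2 = true then g z.1 else 0) ∂(P.map (fun ω => (π ω, U ω))) := by
    rw [integral_map (hπ.prodMk hU).aemeasurable hf.aestronglyMeasurable]
    refine integral_congr_ae (Filter.Eventually.of_forall fun ω => ?_)
    simp [U, Set.indicator_apply]
  rw [e1, ← ProbabilityTheory.compProd_map_condDistrib hU.aemeasurable,
    Measure.integral_compProd, integral_map hπ.aemeasurable]
  · refine integral_congr_ae (Filter.Eventually.of_forall fun ω => ?_)
    have : (fun y : Bool => if y = true then g (π ω) else 0)
        = ({true} : Set Bool).indicator fun _ => g (π ω) := by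
      ext y; simp [Set.indicator_apply]
    simp only [this]
    rw [integral_indicator_const _ (measurableSet_singleton _)]
    simp [κ]
  · exact (StronglyMeasurable.integral_kernel_prod_right'
      hf.stronglyMeasurable).aestronglyMeasurable
  · rw [ProbabilityTheory.compProd_map_condDistrib hU.aemeasurable]; exact hint

/-! ### The decoupling inequality -/

theorem integrable_of_abs_le {Ω : Type*} [MeasurableSpace Ω] {P : Measure Ω} [IsFiniteMeasure P]
    {g : Ω → ℝ} (hg : Measurable g) {c : ℝ} (hc : ∀ ω, |g ω| ≤ c) : Integrable g P :=
  Integrable.of_bound hg.aestronglyMeasurable c (Filter.Eventually.of_forall hc)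

theorem abs_integral_density_mul_le {W : Type*} [MeasurableSpace W] {p₁ : Measure W}
    {q g : W → ℝ} (hq0 : ∀ w, 0 ≤ q w) (hqi : Integrable q p₁) (hq1 : ∫ w, q w ∂p₁ = 1)
    {c : ℝ} (hc : ∀ w, |g w| ≤ c) : |∫ w, q w * g w ∂p₁| ≤ c := by
  calc |∫ w, q w * g w ∂p₁| ≤ ∫ w, q w * c ∂p₁ := by
        rw [← Real.norm_eq_abs]
        refine norm_integral_le_of_norm_le (hqi.mul_const c)
          (Filter.Eventually.of_forall fun w => ?_)
        rw [Real.norm_eq_abs, abs_mul, abs_of_nonneg (hq0 w)]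
        exact mul_le_mul_of_nonneg_left (hc w) (hq0 w)
    _ = c := by rw [integral_mul_const, hq1, one_mul]

theorem integrable_density_mul {W : Type*} [MeasurableSpace W] {p₁ : Measure W}
    {q g : W → ℝ} (hqi : Integrable q p₁) (hg : Measurable g)
    {c : ℝ} (hc : ∀ w, |g w| ≤ c) : Integrable (fun w => q w * g w) p₁ :=
  hqi.mul_bdd hg.aestronglyMeasurable (Filter.Eventually.of_forall hc)

theorem measurable_integral_density_mul {O W : Type*} [MeasurableSpace O] [MeasurableSpace W]
    {p₁ : Measure W} [SFinite p₁] {q h : O → W → ℝ} (hq : Measurable (Function.uncurry q))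
    (hh : Measurable (Function.uncurry h)) : Measurable fun o => ∫ w, q o w * h o w ∂p₁ :=
  (StronglyMeasurable.integral_prod_right (f := fun o w => q o w * h o w)
    (hq.mul hh).stronglyMeasurable).measurable

/-- One action of the decoupling inequality. On the event `E` that the action is played, with
conditional probability `p`, one has `g ≤ 1 / (4 μ p) + μ p g²`. The first term integrates to
`1 / (4 μ)` over `E`; in the second, `p` may be replaced by the indicator of `E` and `g²` by its
posterior mean, because the sample `ν` enters only through a function of `π` and `ν`. -/
theorem integral_indicator_action_le {Ω Ω' W : Type*} [MeasurableSpace Ω]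
    [MeasurableSpace Ω'] [MeasurableSpace W] {P : Measure Ω} [IsProbabilityMeasure P]
    {p₁ : Measure W} [IsProbabilityMeasure p₁] {π : Ω → Ω'} (hπ : Measurable π) {ν : Ω → W}
    (hν : Measurable ν) {q : Ω' → W → ℝ} (hq : Measurable (Function.uncurry q))
    (hq0 : ∀ o w, 0 ≤ q o w) (hqi : ∀ o, Integrable (q o) p₁) (hq1 : ∀ o, ∫ w, q o w ∂p₁ = 1)
    (hrect : ∀ S B, MeasurableSet S → MeasurableSet B →
      P (π ⁻¹' S ∩ ν ⁻¹' B)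
        = ∫⁻ ω in π ⁻¹' S, ∫⁻ w in B, ENNReal.ofReal (q (π ω) w) ∂p₁ ∂P)
    {E : Set Ω} (hE : MeasurableSet E)
    {g : Ω' → W → ℝ} (hg : Measurable (Function.uncurry g)) {c : ℝ} (hc : ∀ o w, |g o w| ≤ c)
    {μ : ℝ} (hμ : 0 < μ) :
    ∫ ω, E.indicator (fun ω => g (π ω) (ν ω)) ω ∂P
      ≤ 1 / (4 * μ) + μ * ∫ ω, E.indicator (fun ω => ∫ w, q (π ω) w * g (π ω) w ^ 2 ∂p₁) ω ∂P := by
  obtain ⟨p, hp, hp01, hpE⟩ := exists_condProb (P := P) hπ hE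
  have hg2 : Measurable (Function.uncurry fun o w => g o w ^ 2) := hg.pow_const 2
  have hg2c : ∀ o w, |g o w ^ 2| ≤ c ^ 2 := fun o w => by
    rw [abs_pow]; exact pow_le_pow_left₀ (abs_nonneg _) (hc o w) 2
  have hgν : Measurable fun ω => g (π ω) (ν ω) := hg.comp (hπ.prodMk hν)
  let V : Ω' → ℝ := fun o => ∫ w, q o w * g o w ^ 2 ∂p₁
  have hV : Measurable V := measurable_integral_density_mul hq hg2
  have hVc : ∀ o, |V o| ≤ c ^ 2 := fun o =>
    abs_integral_density_mul_le (hq0 o) (hqi o) (hq1 o) (hg2c o)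
  have hpg : ∫ ω, p (π ω) * g (π ω) (ν ω) ^ 2 ∂P = ∫ ω, E.indicator (fun ω => V (π ω)) ω ∂P := by
    rw [hpE V hV ⟨_, hVc⟩]
    have := integral_comp_eq_integral_integral_density hπ hν hq hq0 hrect
      (h := fun o w => p o * g o w ^ 2) (show Measurable fun z : Ω' × W =>
        p z.1 * g z.1 z.2 ^ 2 from (hp.comp measurable_fst).mul hg2) (c := 1 * c ^ 2)
      (fun o w => by
        rw [abs_mul, abs_of_nonneg (hp01 o).1]
        exact mul_le_mul (hp01 o).2 (hg2c o w) (abs_nonneg _) zero_le_one)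
    rw [this]
    refine integral_congr_ae (Filter.Eventually.of_forall fun ω => ?_)
    simp only [V]
    rw [← integral_const_mul]
    refine integral_congr_ae (Filter.Eventually.of_forall fun w => ?_)
    simp only
    ring
  refine le_of_forall_pos_le_add fun δ hδ => ?_
  -- regularise the conditional probability `p`, which may vanish, by a small `κ`
  obtain ⟨κ, hκ, hκδ⟩ : ∃ κ : ℝ, 0 < κ ∧ μ * κ * c ^ 2 ≤ δ := by
    refine ⟨δ / (μ * (c ^ 2 + 1)), by positivity, ?_⟩
    have h1 : μ * (δ / (μ * (c ^ 2 + 1))) * c ^ 2 = δ * (c ^ 2 / (c ^ 2 + 1)) := by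
      field_simp
    rw [h1]
    exact mul_le_of_le_one_right hδ.le (div_le_one_of_le₀ (by linarith) (by positivity))
  have hpκ : ∀ o, 0 < p o + κ := fun o => by linarith [(hp01 o).1]
  let u : Ω' → ℝ := fun o => 1 / (4 * μ * (p o + κ))
  have hu : Measurable u := by fun_prop
  have huc : ∀ o, |u o| ≤ 1 / (4 * μ * κ) := fun o => by
    have := hpκ o
    rw [abs_of_nonneg (by simp only [u]; positivity)]
    refine one_div_le_one_div_of_le (by positivity) ?_
    exact mul_le_mul_of_nonneg_left (by linarith [(hp01 o).1]) (by positivity)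
  have hu1 : ∫ ω, E.indicator (fun ω => u (π ω)) ω ∂P ≤ 1 / (4 * μ) := by
    rw [hpE u hu ⟨_, huc⟩]
    have hb : ∀ o, 0 ≤ p o * u o ∧ p o * u o ≤ 1 / (4 * μ) := fun o => by
      have h1 := hpκ o
      have h2 := (hp01 o).1
      refine ⟨mul_nonneg h2 (by simp only [u]; positivity), ?_⟩
      have : p o * u o = 1 / (4 * μ) * (p o / (p o + κ)) := by
        simp only [u]; field_simp
      rw [this]
      exact mul_le_of_le_one_right (by positivity) (div_le_one_of_le₀ (by linarith) h1.le)
    calc ∫ ω, p (π ω) * u (π ω) ∂P ≤ ∫ ω, 1 / (4 * μ) ∂P :=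
          integral_mono (integrable_of_abs_le (by fun_prop)
            (fun ω => by rw [abs_of_nonneg (hb _).1]; exact (hb _).2))
            (integrable_const _) fun ω => (hb _).2
      _ = 1 / (4 * μ) := by simp
  have i1 : Integrable (E.indicator fun ω => u (π ω)) P :=
    (integrable_of_abs_le (hu.comp hπ) fun ω => huc _).indicator hE
  have i2 : Integrable (fun ω => p (π ω) * g (π ω) (ν ω) ^ 2) P :=
    integrable_of_abs_le (c := 1 * c ^ 2) (by fun_prop) fun ω => by
      rw [abs_mul, abs_of_nonneg (hp01 _).1]
      exact mul_le_mul (hp01 _).2 (hg2c _ _) (abs_nonneg _) zero_le_one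
  calc ∫ ω, E.indicator (fun ω => g (π ω) (ν ω)) ω ∂P
      ≤ ∫ ω, (E.indicator (fun ω => u (π ω)) ω + μ * (p (π ω) * g (π ω) (ν ω) ^ 2)
          + μ * κ * c ^ 2) ∂P := by
        refine integral_mono
          ((integrable_of_abs_le hgν fun ω => hc _ _).indicator hE)
          ((i1.add (i2.const_mul μ)).add (integrable_const _)) fun ω => ?_
        have h1 := hpκ (π ω)
        have h2 := (hp01 (π ω)).1
        have h3 : μ * κ * g (π ω) (ν ω) ^ 2 ≤ μ * κ * c ^ 2 :=
          mul_le_mul_of_nonneg_left ((le_abs_self _).trans (hg2c _ _)) (by positivity)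
        by_cases hω : ω ∈ E
        · simp only [Set.indicator_of_mem hω]
          have h4 : g (π ω) (ν ω)
              ≤ u (π ω) + μ * (p (π ω) + κ) * g (π ω) (ν ω) ^ 2 := by
            have : u (π ω) + μ * (p (π ω) + κ) * g (π ω) (ν ω) ^ 2 - g (π ω) (ν ω)
                = (2 * μ * (p (π ω) + κ) * g (π ω) (ν ω) - 1) ^ 2 / (4 * μ * (p (π ω) + κ)) := by
              simp only [u]; field_simp; ring
            have h5 : 0 ≤ (2 * μ * (p (π ω) + κ) * g (π ω) (ν ω) - 1) ^ 2
              / (4 * μ * (p (π ω) + κ)) := by positivity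
            linarith
          nlinarith
        · simp only [Set.indicator_of_notMem hω]
          positivity
    _ = ∫ ω, E.indicator (fun ω => u (π ω)) ω ∂P
          + μ * ∫ ω, p (π ω) * g (π ω) (ν ω) ^ 2 ∂P + μ * κ * c ^ 2 := by
        have i3 : Integrable (fun ω => E.indicator (fun ω => u (π ω)) ω
            + μ * (p (π ω) * g (π ω) (ν ω) ^ 2)) P := i1.add (i2.const_mul μ)
        have i1' : Integrable (fun ω => E.indicator (fun ω => u (π ω)) ω) P := i1
        rw [integral_add i3 (integrable_const _), integral_add i1' (i2.const_mul μ),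
          integral_const_mul]
        simp
    _ ≤ _ := by
        rw [hpg]
        linarith

/-- The decoupling inequality of Thompson sampling: the action `A` may depend on the sample `ν` in
any way, but the mean of `g` at `(ν, A)` is controlled by the mean of `g²` at `(w, A)` with `w` a
fresh posterior sample, at the price `K / (4 μ)`. -/
theorem integral_action_gap_le {Ω Ω' W : Type*} [MeasurableSpace Ω]
    [MeasurableSpace Ω'] [MeasurableSpace W] {P : Measure Ω} [IsProbabilityMeasure P]
    {p₁ : Measure W} [IsProbabilityMeasure p₁] {π : Ω → Ω'} (hπ : Measurable π) {ν : Ω → W}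
    (hν : Measurable ν) {q : Ω' → W → ℝ} (hq : Measurable (Function.uncurry q))
    (hq0 : ∀ o w, 0 ≤ q o w) (hqi : ∀ o, Integrable (q o) p₁) (hq1 : ∀ o, ∫ w, q o w ∂p₁ = 1)
    (hrect : ∀ S B, MeasurableSet S → MeasurableSet B →
      P (π ⁻¹' S ∩ ν ⁻¹' B)
        = ∫⁻ ω in π ⁻¹' S, ∫⁻ w in B, ENNReal.ofReal (q (π ω) w) ∂p₁ ∂P)
    {K : ℕ} {A : Ω → Fin K} (hA : Measurable A)
    {g : Ω' → W → Fin K → ℝ} (hg : ∀ a, Measurable (Function.uncurry fun o w => g o w a))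
    {c : ℝ} (hc : ∀ o w a, |g o w a| ≤ c) {μ : ℝ} (hμ : 0 < μ) :
    ∫ ω, g (π ω) (ν ω) (A ω) ∂P
      ≤ K / (4 * μ) + μ * ∫ ω, ∫ w, q (π ω) w * g (π ω) w (A ω) ^ 2 ∂p₁ ∂P := by
  let E : Fin K → Set Ω := fun a => A ⁻¹' {a}
  have hE : ∀ a, MeasurableSet (E a) := fun a => hA (measurableSet_singleton a)
  have hsum : ∀ u : Fin K → Ω → ℝ, ∀ ω, u (A ω) ω = ∑ a, (E a).indicator (u a) ω := by
    intro u ω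
    rw [Finset.sum_eq_single (A ω)]
    · rw [Set.indicator_of_mem]; rfl
    · intro b _ hb
      rw [Set.indicator_of_notMem]
      exact fun h => hb (Eq.symm h)
    · simp
  have hg2 : ∀ a, Measurable (Function.uncurry fun o w => g o w a ^ 2) :=
    fun a => (hg a).pow_const 2
  have hg2c : ∀ o w a, |g o w a ^ 2| ≤ c ^ 2 := fun o w a => by
    rw [abs_pow]; exact pow_le_pow_left₀ (abs_nonneg _) (hc o w a) 2
  have e1 : ∫ ω, g (π ω) (ν ω) (A ω) ∂P
      = ∑ a, ∫ ω, (E a).indicator (fun ω => g (π ω) (ν ω) a) ω ∂P := by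
    rw [← integral_finsetSum]
    · exact integral_congr_ae (Filter.Eventually.of_forall fun ω =>
        hsum (fun a ω => g (π ω) (ν ω) a) ω)
    · exact fun a _ => (integrable_of_abs_le ((hg a).comp (hπ.prodMk hν))
        fun ω => hc _ _ _).indicator (hE a)
  have e2 : ∫ ω, ∫ w, q (π ω) w * g (π ω) w (A ω) ^ 2 ∂p₁ ∂P
      = ∑ a, ∫ ω, (E a).indicator (fun ω => ∫ w, q (π ω) w * g (π ω) w a ^ 2 ∂p₁) ω ∂P := by
    rw [← integral_finsetSum]
    · exact integral_congr_ae (Filter.Eventually.of_forall fun ω =>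
        hsum (fun a ω => ∫ w, q (π ω) w * g (π ω) w a ^ 2 ∂p₁) ω)
    · intro a _
      refine Integrable.indicator ?_ (hE a)
      exact integrable_of_abs_le ((measurable_integral_density_mul hq (hg2 a)).comp hπ)
        fun ω => abs_integral_density_mul_le (hq0 _) (hqi _) (hq1 _) fun w => hg2c _ w a
  rw [e1, e2, Finset.mul_sum]
  calc _ ≤ ∑ a : Fin K, (1 / (4 * μ) + μ *
        ∫ ω, (E a).indicator (fun ω => ∫ w, q (π ω) w * g (π ω) w a ^ 2 ∂p₁) ω ∂P) :=
        Finset.sum_le_sum fun a _ => integral_indicator_action_le hπ hν hq hq0 hqi hq1 hrect (hE a)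
          (hg a) (fun o w => hc o w a) hμ
    _ = _ := by
        rw [Finset.sum_add_distrib]
        simp
        ring

/-! ### One round of Feel-Good Thompson Sampling -/

/-- The elementary inequality behind one round. From `exp u ≤ 1 + u + u²` for `u ≤ 1`; the square is
absorbed up to a term of order `lam²`, and a negative multiple of `g²` survives. The coefficient
`7 / 32` is `1 / 4 - 1 / 32`, the second part being the price of the noise. -/
theorem exp_quadratic_le {g F lam : ℝ} (hg : |g| ≤ 2) (hF : |F| ≤ 2) (h0 : 0 ≤ lam)
    (h1 : lam ≤ 1 / 2) :
    Real.exp (-(7 / 32) * g ^ 2 + lam * F) ≤ 1 - 7 / 512 * g ^ 2 + lam * F + 60 * lam ^ 2 := by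
  set u := -(7 / 32) * g ^ 2 + lam * F with hu
  obtain ⟨hF1, hF2⟩ := abs_le.1 hF
  have hu1 : u ≤ 1 := by nlinarith [sq_nonneg g]
  have hexp : Real.exp u ≤ 1 + u + u ^ 2 := by
    rcases le_total (-1) u with h | h
    · have := Real.abs_exp_sub_one_sub_id_le (abs_le.2 ⟨h, hu1⟩)
      linarith [(abs_le.1 this).2]
    · have : Real.exp u ≤ 1 := Real.exp_le_one_iff.2 (by linarith)
      nlinarith
  have hgsq : g ^ 2 ≤ 4 := by nlinarith [abs_le.1 hg, sq_abs g, abs_nonneg g]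
  have hFsq : F ^ 2 ≤ 4 := by nlinarith
  -- weighted Young inequality: `15/14 * 7/8 < 1` leaves a negative multiple of `g ^ 2`
  have hsq : u ^ 2 ≤ 15 / 14 * (7 / 32 * g ^ 2) ^ 2 + 15 * (lam * F) ^ 2 := by
    rw [hu]
    nlinarith [sq_nonneg (7 / 32 * g ^ 2 + 14 * (lam * F))]
  have h2 : (7 / 32 * g ^ 2) ^ 2 ≤ 7 / 8 * (7 / 32 * g ^ 2) := by nlinarith [sq_nonneg g]
  have h3 : (lam * F) ^ 2 ≤ 4 * lam ^ 2 := by nlinarith [sq_nonneg lam]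
  linarith

/-- The expected ratio of two consecutive partition functions. Here `g o w a` is the gap between the
rewards of `w` and of the true parameter at action `a`, and `F o w` is the gap between their maximal
rewards. Averaging over the noise first turns the linear term into `g² / 32`. -/
theorem integrable_and_integral_likelihood_ratio_le {Ω Ω' W : Type*} [MeasurableSpace Ω]
    [MeasurableSpace Ω'] [MeasurableSpace W] {P : Measure Ω} [IsProbabilityMeasure P]
    {p₁ : Measure W} [IsProbabilityMeasure p₁] {π : Ω → Ω'} (hπ : Measurable π)
    {q : Ω' → W → ℝ} (hq : Measurable (Function.uncurry q))
    (hq0 : ∀ o w, 0 ≤ q o w) (hqi : ∀ o, Integrable (q o) p₁) (hq1 : ∀ o, ∫ w, q o w ∂p₁ = 1)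
    {K : ℕ} {A : Ω → Fin K} (hA : Measurable A)
    {g : Ω' → W → Fin K → ℝ} (hg : ∀ a, Measurable (Function.uncurry fun o w => g o w a))
    (hg2 : ∀ o w a, |g o w a| ≤ 2)
    {F : Ω' → W → ℝ} (hF : Measurable (Function.uncurry F)) (hF2 : ∀ o w, |F o w| ≤ 2)
    {ε : Ω → ℝ} (hε : Measurable ε)
    (hSG : ∀ θ b : Ω' → Fin K → ℝ, (∀ a, Measurable fun o => θ o a) →
      (∀ a, Measurable fun o => b o a) → (∀ o a, |θ o a| ≤ 1) → (∀ o a, 0 ≤ b o a) →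
      ∫⁻ ω, ENNReal.ofReal (b (π ω) (A ω) * Real.exp (θ (π ω) (A ω) * ε ω)) ∂P
        ≤ ∫⁻ ω, ENNReal.ofReal (b (π ω) (A ω) * Real.exp (θ (π ω) (A ω) ^ 2 / 8)) ∂P)
    {lam : ℝ} (h0 : 0 ≤ lam) (h1 : lam ≤ 1 / 2) :
    Integrable (fun ω => ∫ w, q (π ω) w * Real.exp (-(1 / 4) * g (π ω) w (A ω) ^ 2
        + 1 / 2 * g (π ω) w (A ω) * ε ω + lam * F (π ω) w) ∂p₁) P ∧
      ∫ ω, ∫ w, q (π ω) w * Real.exp (-(1 / 4) * g (π ω) w (A ω) ^ 2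
        + 1 / 2 * g (π ω) w (A ω) * ε ω + lam * F (π ω) w) ∂p₁ ∂P
      ≤ 1 - 7 / 512 * ∫ ω, ∫ w, q (π ω) w * g (π ω) w (A ω) ^ 2 ∂p₁ ∂P
        + lam * ∫ ω, ∫ w, q (π ω) w * F (π ω) w ∂p₁ ∂P + 60 * lam ^ 2 := by
  have hgA : Measurable fun z : Ω × W => g (π z.1) z.2 (A z.1) := by
    have h : Measurable fun z : (Ω' × W) × Fin K => g z.1.1 z.1.2 z.2 :=
      measurable_from_prod_countable_left fun a => hg a
    exact h.comp (((hπ.comp measurable_fst).prodMk measurable_snd).prodMk (hA.comp measurable_fst))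
  have hFπ : Measurable fun z : Ω × W => F (π z.1) z.2 :=
    hF.comp ((hπ.comp measurable_fst).prodMk measurable_snd)
  have hqπ : Measurable fun z : Ω × W => q (π z.1) z.2 :=
    hq.comp ((hπ.comp measurable_fst).prodMk measurable_snd)
  have hεf : Measurable fun z : Ω × W => ε z.1 := hε.comp measurable_fst
  let G : Ω → W → ℝ := fun ω w => q (π ω) w * Real.exp (-(1 / 4) * g (π ω) w (A ω) ^ 2
        + 1 / 2 * g (π ω) w (A ω) * ε ω + lam * F (π ω) w)
  let H : Ω → W → ℝ := fun ω w => q (π ω) w *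
    Real.exp (-(7 / 32) * g (π ω) w (A ω) ^ 2 + lam * F (π ω) w)
  have hG : Measurable fun z : Ω × W => G z.1 z.2 := by
    have aux : ∀ a b c d : Ω × W → ℝ, Measurable a → Measurable b → Measurable c → Measurable d →
        Measurable fun z =>
          a z * Real.exp (-(1 / 4) * b z ^ 2 + 1 / 2 * b z * d z + lam * c z) := by
      intros; fun_prop
    exact aux _ _ _ _ hqπ hgA hFπ hεf
  have hH : Measurable fun z : Ω × W => H z.1 z.2 := by
    have aux : ∀ a b c : Ω × W → ℝ, Measurable a → Measurable b → Measurable c →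
        Measurable fun z => a z * Real.exp (-(7 / 32) * b z ^ 2 + lam * c z) := by
      intros; fun_prop
    exact aux _ _ _ hqπ hgA hFπ
  have hG0 : ∀ ω w, 0 ≤ G ω w := fun ω w => mul_nonneg (hq0 _ _) (Real.exp_pos _).le
  have hH0 : ∀ ω w, 0 ≤ H ω w := fun ω w => mul_nonneg (hq0 _ _) (Real.exp_pos _).le
  have hgw : ∀ ω, Measurable fun w => g (π ω) w (A ω) := fun ω =>
    hgA.comp (measurable_const (a := ω) |>.prodMk measurable_id)
  have hFw : ∀ ω, Measurable fun w => F (π ω) w := fun ω =>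
    hFπ.comp (measurable_const (a := ω) |>.prodMk measurable_id)
  have hlF : ∀ ω w, lam * F (π ω) w ≤ 1 := fun ω w => by
    nlinarith [(abs_le.1 (hF2 (π ω) w)).2]
  have hGi : ∀ ω, Integrable (G ω) p₁ := fun ω => by
    have := hgw ω
    have := hFw ω
    refine integrable_density_mul (hqi _) (by fun_prop) (c := Real.exp (|ε ω| + 1)) fun w => ?_
    rw [abs_of_pos (Real.exp_pos _)]
    refine Real.exp_le_exp.2 ?_
    have h2 : 1 / 2 * g (π ω) w (A ω) * ε ω ≤ |ε ω| := by
      refine (le_abs_self _).trans ?_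
      rw [abs_mul]
      refine mul_le_of_le_one_left (abs_nonneg _) ?_
      rw [abs_mul, abs_of_pos (by norm_num : (0 : ℝ) < 1 / 2)]
      linarith [hg2 (π ω) w (A ω)]
    nlinarith [sq_nonneg (g (π ω) w (A ω)), hlF ω w]
  have hg4 : ∀ o w a, |g o w a ^ 2| ≤ 4 := fun o w a => by
    rw [abs_pow]; nlinarith [hg2 o w a, abs_nonneg (g o w a)]
  have hHb : ∀ ω w, H ω w ≤ q (π ω) w - 7 / 512 * (q (π ω) w * g (π ω) w (A ω) ^ 2)
      + lam * (q (π ω) w * F (π ω) w) + 60 * lam ^ 2 * q (π ω) w := fun ω w => by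
    have := mul_le_mul_of_nonneg_left
      (exp_quadratic_le (hg2 (π ω) w (A ω)) (hF2 (π ω) w) h0 h1) (hq0 (π ω) w)
    simp only [H]
    linarith
  have hHi : ∀ ω, Integrable (H ω) p₁ := fun ω => by
    have := hgw ω
    have := hFw ω
    refine integrable_density_mul (hqi _) (by fun_prop) (c := Real.exp 1) fun w => ?_
    rw [abs_of_pos (Real.exp_pos _)]
    refine Real.exp_le_exp.2 ?_
    nlinarith [sq_nonneg (g (π ω) w (A ω)), hlF ω w]
  let V : Ω → ℝ := fun ω => ∫ w, q (π ω) w * g (π ω) w (A ω) ^ 2 ∂p₁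
  let B : Ω → ℝ := fun ω => ∫ w, q (π ω) w * F (π ω) w ∂p₁
  have hV : Integrable V P := integrable_of_abs_le
    (measurable_integral_density_mul (q := fun ω w => q (π ω) w)
      (h := fun ω w => g (π ω) w (A ω) ^ 2) hqπ (hgA.pow_const 2))
    fun ω => abs_integral_density_mul_le (hq0 _) (hqi _) (hq1 _) fun w => hg4 _ w _
  have hB : Integrable B P := integrable_of_abs_le
    (measurable_integral_density_mul (q := fun ω w => q (π ω) w)
      (h := fun ω w => F (π ω) w) hqπ hFπ)
    fun ω => abs_integral_density_mul_le (hq0 _) (hqi _) (hq1 _) fun w => hF2 _ w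
  let T : Ω → ℝ := fun ω => 1 - 7 / 512 * V ω + lam * B ω + 60 * lam ^ 2
  have hTi : Integrable T P :=
    (((integrable_const _).sub (hV.const_mul _)).add (hB.const_mul _)).add (integrable_const _)
  have hHT : ∀ ω, ∫ w, H ω w ∂p₁ ≤ T ω := fun ω => by
    have i1 : Integrable (fun w => q (π ω) w) p₁ := hqi _
    have i2 : Integrable (fun w => q (π ω) w * g (π ω) w (A ω) ^ 2) p₁ :=
      integrable_density_mul (hqi _) ((hgw ω).pow_const 2) fun w => hg4 _ w _
    have i3 : Integrable (fun w => q (π ω) w * F (π ω) w) p₁ :=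
      integrable_density_mul (hqi _) (hFw ω) fun w => hF2 _ w
    have j1 : Integrable (fun w => q (π ω) w - 7 / 512 * (q (π ω) w * g (π ω) w (A ω) ^ 2)) p₁ :=
      i1.sub (i2.const_mul _)
    have j2 : Integrable (fun w => q (π ω) w - 7 / 512 * (q (π ω) w * g (π ω) w (A ω) ^ 2)
        + lam * (q (π ω) w * F (π ω) w)) p₁ := j1.add (i3.const_mul _)
    refine (integral_mono (hHi ω) (j2.add (i1.const_mul (60 * lam ^ 2))) (hHb ω)).trans
      (le_of_eq ?_)
    simp only [Pi.add_apply]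
    rw [integral_add j2 (i1.const_mul _), integral_add j1 (i3.const_mul _),
      integral_sub i1 (i2.const_mul _), integral_const_mul, integral_const_mul,
      integral_const_mul, hq1]
    simp only [T, V, B]
    ring
  have hT0 : ∀ ω, 0 ≤ T ω := fun ω => (integral_nonneg (hH0 ω)).trans (hHT ω)
  have hR : Measurable fun ω => ∫ w, G ω w ∂p₁ :=
    (StronglyMeasurable.integral_prod_right (f := G) hG.stronglyMeasurable).measurable
  have hR0 : ∀ ω, 0 ≤ ∫ w, G ω w ∂p₁ := fun ω => integral_nonneg (hG0 ω)
  have hGl : Measurable fun z : Ω × W => ENNReal.ofReal (G z.1 z.2) := hG.ennreal_ofReal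
  have hHl : Measurable fun z : Ω × W => ENNReal.ofReal (H z.1 z.2) := hH.ennreal_ofReal
  have key : ∫⁻ ω, ENNReal.ofReal (∫ w, G ω w ∂p₁) ∂P ≤ ∫⁻ ω, ENNReal.ofReal (T ω) ∂P := by
    calc ∫⁻ ω, ENNReal.ofReal (∫ w, G ω w ∂p₁) ∂P
        = ∫⁻ ω, ∫⁻ w, ENNReal.ofReal (G ω w) ∂p₁ ∂P := lintegral_congr fun ω =>
          ofReal_integral_eq_lintegral_ofReal (hGi ω) (Filter.Eventually.of_forall (hG0 ω))
      _ = ∫⁻ w, ∫⁻ ω, ENNReal.ofReal (G ω w) ∂P ∂p₁ := lintegral_lintegral_swap hGl.aemeasurable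
      _ ≤ ∫⁻ w, ∫⁻ ω, ENNReal.ofReal (H ω w) ∂P ∂p₁ := by
          refine lintegral_mono fun w => ?_
          have hgw' : ∀ a, Measurable fun o => g o w a := fun a =>
            (hg a).comp (measurable_id.prodMk measurable_const)
          have hFw' : Measurable fun o => F o w := hF.comp (measurable_id.prodMk measurable_const)
          have hqw' : Measurable fun o => q o w := hq.comp (measurable_id.prodMk measurable_const)
          have := hSG (fun o a => 1 / 2 * g o w a)
            (fun o a => q o w * Real.exp (-(1 / 4) * g o w a ^ 2 + lam * F o w))
            (fun a => by have := hgw' a; fun_prop) (fun a => by have := hgw' a; fun_prop)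
            (fun o a => by
              rw [abs_mul, abs_of_pos (by norm_num : (0 : ℝ) < 1 / 2)]; linarith [hg2 o w a])
            (fun o a => mul_nonneg (hq0 _ _) (Real.exp_pos _).le)
          refine le_trans (le_of_eq ?_) (this.trans (le_of_eq ?_))
          · refine lintegral_congr fun ω => ?_
            simp only [G]
            rw [mul_assoc (q (π ω) w), ← Real.exp_add]
            congr 3
            ring
          · refine lintegral_congr fun ω => ?_
            simp only [H]
            rw [mul_assoc (q (π ω) w), ← Real.exp_add]
            congr 3
            ring
      _ = ∫⁻ ω, ∫⁻ w, ENNReal.ofReal (H ω w) ∂p₁ ∂P :=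
          (lintegral_lintegral_swap hHl.aemeasurable).symm
      _ ≤ ∫⁻ ω, ENNReal.ofReal (T ω) ∂P := lintegral_mono fun ω => by
          rw [← ofReal_integral_eq_lintegral_ofReal (hHi ω) (Filter.Eventually.of_forall (hH0 ω))]
          exact ENNReal.ofReal_le_ofReal (hHT ω)
  have hTfin : ∫⁻ ω, ENNReal.ofReal (T ω) ∂P ≠ ⊤ := by
    rw [← ofReal_integral_eq_lintegral_ofReal hTi (Filter.Eventually.of_forall hT0)]
    exact ENNReal.ofReal_ne_top
  refine ⟨⟨hR.aestronglyMeasurable, ?_⟩, ?_⟩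
  · rw [hasFiniteIntegral_iff_ofReal (Filter.Eventually.of_forall hR0)]
    exact key.trans_lt (lt_top_iff_ne_top.2 hTfin)
  · have hT' : ∫ ω, T ω ∂P = 1 - 7 / 512 * ∫ ω, V ω ∂P + lam * ∫ ω, B ω ∂P + 60 * lam ^ 2 := by
      have j1 : Integrable (fun ω => 1 - 7 / 512 * V ω) P :=
        (integrable_const _).sub (hV.const_mul _)
      have j2 : Integrable (fun ω => 1 - 7 / 512 * V ω + lam * B ω) P := j1.add (hB.const_mul _)
      simp only [T]
      rw [integral_add j2 (integrable_const _), integral_add j1 (hB.const_mul _),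
        integral_sub (integrable_const _) (hV.const_mul _), integral_const_mul, integral_const_mul]
      simp
    rw [← hT']
    rw [integral_eq_lintegral_of_nonneg_ae (Filter.Eventually.of_forall hR0)
      hR.aestronglyMeasurable, integral_eq_lintegral_of_nonneg_ae (Filter.Eventually.of_forall hT0)
      hTi.aestronglyMeasurable]
    exact ENNReal.toReal_mono hTfin key

theorem abs_iSup_le_one {ι : Type*} [Finite ι] {u : ι → ℝ} (hu : ∀ i, |u i| ≤ 1) :
    |⨆ i, u i| ≤ 1 := by
  rcases isEmpty_or_nonempty ι with h | h
  · simp [Real.iSup_of_isEmpty]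
  · refine abs_le.2 ⟨?_, ciSup_le fun i => (abs_le.1 (hu i)).2⟩
    obtain ⟨i⟩ := h
    exact (abs_le.1 (hu i)).1.trans (le_ciSup (Set.finite_range u).bddAbove i)

/-- The regret of one round, up to a term of order `lam² K`, is paid for by `1 - E R`, where `R` is
the ratio of consecutive partition functions: the posterior mean of the squared gap that the
decoupling inequality produces cancels against the one in the bound for `E R`, and so does the
feel-good term. The space `Ω'` carries what is known before the action is played. -/
theorem round_regret_le {Ω Ω' W Z : Type*} [MeasurableSpace Ω]
    {mΩ' : MeasurableSpace Ω'} [MeasurableSpace W] [MeasurableSpace Z]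
    {P : Measure Ω} [IsProbabilityMeasure P]
    {p₁ : Measure W} [IsProbabilityMeasure p₁] {π : Ω → Ω'} (hπ : Measurable π)
    {ν : Ω → W} (hν : Measurable ν)
    {q : Ω' → W → ℝ} (hq : Measurable (Function.uncurry q))
    (hq0 : ∀ o w, 0 ≤ q o w) (hqi : ∀ o, Integrable (q o) p₁) (hq1 : ∀ o, ∫ w, q o w ∂p₁ = 1)
    (hrect : ∀ S B, MeasurableSet S → MeasurableSet B →
      P (π ⁻¹' S ∩ ν ⁻¹' B)
        = ∫⁻ ω in π ⁻¹' S, ∫⁻ w in B, ENNReal.ofReal (q (π ω) w) ∂p₁ ∂P)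
    {K : ℕ} {A : Ω → Fin K} (hA : Measurable A)
    {x : Ω' → Fin K → Z} (hx : Measurable x) {f : W → Z → ℝ} (hf : Measurable (Function.uncurry f))
    (hf1 : ∀ w z, |f w z| ≤ 1) {fs : Z → ℝ} (hfs : Measurable fs) (hfs1 : ∀ z, |fs z| ≤ 1)
    (hgreedy : ∀ᵐ ω ∂P, ∀ b, f (ν ω) (x (π ω) b) ≤ f (ν ω) (x (π ω) (A ω)))
    {ε : Ω → ℝ} (hε : Measurable ε)
    (hSG : ∀ θ b : Ω' → Fin K → ℝ, (∀ a, Measurable fun o => θ o a) →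
      (∀ a, Measurable fun o => b o a) → (∀ o a, |θ o a| ≤ 1) → (∀ o a, 0 ≤ b o a) →
      ∫⁻ ω, ENNReal.ofReal (b (π ω) (A ω) * Real.exp (θ (π ω) (A ω) * ε ω)) ∂P
        ≤ ∫⁻ ω, ENNReal.ofReal (b (π ω) (A ω) * Real.exp (θ (π ω) (A ω) ^ 2 / 8)) ∂P)
    {lam : ℝ} (h0 : 0 < lam) (h1 : lam ≤ 1 / 2) {R : Ω → ℝ}
    (hR : ∀ ω, R ω = ∫ w, q (π ω) w * Real.exp
        (-(1 / 4) * (f w (x (π ω) (A ω)) - fs (x (π ω) (A ω))) ^ 2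
        + 1 / 2 * (f w (x (π ω) (A ω)) - fs (x (π ω) (A ω))) * ε ω
        + lam * ((⨆ a, f w (x (π ω) a)) - ⨆ a, fs (x (π ω) a))) ∂p₁) :
    Integrable R P ∧
      lam * ∫ ω, ((⨆ a, fs (x (π ω) a)) - fs (x (π ω) (A ω))) ∂P
        ≤ lam ^ 2 * (128 / 7 * K + 60) + (1 - ∫ ω, R ω ∂P) := by
  let g : Ω' → W → Fin K → ℝ := fun o w a => f w (x o a) - fs (x o a)
  let F : Ω' → W → ℝ := fun o w => (⨆ a, f w (x o a)) - ⨆ a, fs (x o a)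
  have hxa : ∀ a, Measurable fun o => x o a := fun a => (measurable_pi_apply a).comp hx
  have hfx : ∀ a, Measurable fun z : Ω' × W => f z.2 (x z.1 a) := fun a =>
    hf.comp (measurable_snd.prodMk ((hxa a).comp measurable_fst))
  have hfsx : ∀ a, Measurable fun o => fs (x o a) := fun a => hfs.comp (hxa a)
  have hg : ∀ a, Measurable (Function.uncurry fun o w => g o w a) := fun a =>
    (hfx a).sub ((hfsx a).comp measurable_fst)
  have hF : Measurable (Function.uncurry F) :=
    (Measurable.iSup hfx).sub ((Measurable.iSup hfsx).comp measurable_fst)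
  have hg2 : ∀ o w a, |g o w a| ≤ 2 := fun o w a =>
    (abs_sub _ _).trans (by linarith [hf1 w (x o a), hfs1 (x o a)])
  have hF2 : ∀ o w, |F o w| ≤ 2 := fun o w => by
    have e1 := abs_iSup_le_one (u := fun a => f w (x o a)) fun a => hf1 w (x o a)
    have e2 := abs_iSup_le_one (u := fun a => fs (x o a)) fun a => hfs1 (x o a)
    exact (abs_sub _ _).trans (by linarith)
  obtain ⟨hRi, hRle⟩ := integrable_and_integral_likelihood_ratio_le (P := P) hπ hq hq0 hqi hq1 hA
    hg hg2 hF hF2 hε hSG h0.le h1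
  have hR' : R = fun ω => ∫ w, q (π ω) w * Real.exp (-(1 / 4) * g (π ω) w (A ω) ^ 2
        + 1 / 2 * g (π ω) w (A ω) * ε ω + lam * F (π ω) w) ∂p₁ := funext hR
  rw [← hR'] at hRi
  rw [show (∫ ω, ∫ w, q (π ω) w * Real.exp (-(1 / 4) * g (π ω) w (A ω) ^ 2
        + 1 / 2 * g (π ω) w (A ω) * ε ω + lam * F (π ω) w) ∂p₁ ∂P) = ∫ ω, R ω ∂P by
    rw [hR']] at hRle
  refine ⟨hRi, ?_⟩
  -- `μ` is chosen so that `lam * μ = 7 / 512`, the coefficient in `exp_quadratic_le`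
  have hgap := integral_action_gap_le hπ hν hq hq0 hqi hq1 hrect hA hg hg2
    (μ := 7 / 512 / lam) (by positivity)
  have hFν := integral_comp_eq_integral_integral_density hπ hν hq hq0 hrect hF hF2
  have hreg : ∫ ω, ((⨆ a, fs (x (π ω) a)) - fs (x (π ω) (A ω))) ∂P
      = ∫ ω, g (π ω) (ν ω) (A ω) ∂P - ∫ ω, F (π ω) (ν ω) ∂P := by
    have hgA : Measurable fun ω => g (π ω) (ν ω) (A ω) := by
      have h : Measurable fun z : (Ω' × W) × Fin K => g z.1.1 z.1.2 z.2 :=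
        measurable_from_prod_countable_left fun a => hg a
      exact h.comp ((hπ.prodMk hν).prodMk hA)
    have hFν' : Measurable fun ω => F (π ω) (ν ω) := hF.comp (hπ.prodMk hν)
    rw [← integral_sub (integrable_of_abs_le hgA fun ω => hg2 _ _ _)
      (integrable_of_abs_le hFν' fun ω => hF2 _ _)]
    refine integral_congr_ae ?_
    filter_upwards [hgreedy] with ω hω
    have : ⨆ a, f (ν ω) (x (π ω) a) = f (ν ω) (x (π ω) (A ω)) := by
      have : Nonempty (Fin K) := ⟨A ω⟩
      exact le_antisymm (ciSup_le hω)
        (le_ciSup (f := fun a => f (ν ω) (x (π ω) a)) (Set.finite_range _).bddAbove (A ω))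
    simp only [g, F, this]
    ring
  rw [hreg, hFν, mul_sub]
  have h2 := mul_le_mul_of_nonneg_left hgap h0.le
  have h3 : lam * (K / (4 * (7 / 512 / lam)) + 7 / 512 / lam *
      ∫ ω, ∫ w, q (π ω) w * g (π ω) w (A ω) ^ 2 ∂p₁ ∂P)
      = lam ^ 2 * (128 / 7 * K)
        + 7 / 512 * ∫ ω, ∫ w, q (π ω) w * g (π ω) w (A ω) ^ 2 ∂p₁ ∂P := by
    field_simp
    ring
  rw [h3] at h2
  linarith

/-! ### Excess losses, partition functions and the posterior -/

/-- The Feel-Good loss (with `η = 1 / 4`) of the parameter `w` minus that of the true reward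
function `fs`. -/
noncomputable def excessLoss {W Z : Type*} {K : ℕ} (lam : ℝ) (f : W → Z → ℝ) (fs : Z → ℝ) (w : W)
    (x : Fin K → Z) (a : Fin K) (y : ℝ) : ℝ :=
  1 / 4 * ((f w (x a) - y) ^ 2 - (fs (x a) - y) ^ 2)
    - lam * ((⨆ b, f w (x b)) - ⨆ b, fs (x b))

/-- The sum of the excess losses of `w` over the first `t` rounds. -/
noncomputable def cumExcess {W Z : Type*} {K : ℕ} (lam : ℝ) (f : W → Z → ℝ) (fs : Z → ℝ)
    (x : ℕ → Fin K → Z) (a : ℕ → Fin K) (y : ℕ → ℝ) (t : ℕ) (w : W) : ℝ :=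
  ∑ l ∈ Finset.range t, excessLoss lam f fs w (x l) (a l) (y l)

/-- The normalising constant of the posterior of round `t`, with losses measured relative to the
true reward function; this changes the constant but not the posterior. -/
noncomputable def partitionFun {W Z : Type*} [MeasurableSpace W] {K : ℕ} (p₁ : Measure W) (lam : ℝ)
    (f : W → Z → ℝ) (fs : Z → ℝ) (x : ℕ → Fin K → Z) (a : ℕ → Fin K) (y : ℕ → ℝ) (t : ℕ) : ℝ :=
  ∫ w, Real.exp (-cumExcess lam f fs x a y t w) ∂p₁

section

variable {W Z : Type*} {K : ℕ} {lam : ℝ} {f : W → Z → ℝ}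
  {fs : Z → ℝ}

theorem abs_excessLoss_le (hf1 : ∀ w z, |f w z| ≤ 1) (hfs1 : ∀ z, |fs z| ≤ 1) (h0 : 0 ≤ lam)
    (w : W) (x : Fin K → Z) (a : Fin K) (y : ℝ) :
    |excessLoss lam f fs w x a y| ≤ 1 + |y| + 2 * lam := by
  have e1 := abs_iSup_le_one (u := fun a => f w (x a)) fun a => hf1 w (x a)
  have e2 := abs_iSup_le_one (u := fun a => fs (x a)) fun a => hfs1 (x a)
  have e3 : |(⨆ b, f w (x b)) - ⨆ b, fs (x b)| ≤ 2 := (abs_sub _ _).trans (by linarith)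
  have e4 : |f w (x a) - fs (x a)| ≤ 2 :=
    (abs_sub _ _).trans (by linarith [hf1 w (x a), hfs1 (x a)])
  have e5 : |f w (x a) + fs (x a) - 2 * y| ≤ 2 + 2 * |y| := by
    refine (abs_sub _ _).trans ?_
    rw [abs_mul, abs_two]
    linarith [abs_add_le (f w (x a)) (fs (x a)), hf1 w (x a), hfs1 (x a)]
  have e6 : |1 / 4 * ((f w (x a) - y) ^ 2 - (fs (x a) - y) ^ 2)| ≤ 1 + |y| := by
    rw [show 1 / 4 * ((f w (x a) - y) ^ 2 - (fs (x a) - y) ^ 2)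
      = 1 / 4 * ((f w (x a) - fs (x a)) * (f w (x a) + fs (x a) - 2 * y)) by ring, abs_mul, abs_mul,
      abs_of_pos (by norm_num : (0 : ℝ) < 1 / 4)]
    nlinarith [abs_nonneg (f w (x a) - fs (x a)), abs_nonneg (f w (x a) + fs (x a) - 2 * y),
      abs_nonneg y, mul_le_mul e4 e5 (abs_nonneg _) zero_le_two]
  have e7 : |lam * ((⨆ b, f w (x b)) - ⨆ b, fs (x b))| ≤ 2 * lam := by
    rw [abs_mul, abs_of_nonneg h0]
    nlinarith
  unfold excessLoss
  refine (abs_sub _ _).trans ?_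
  linarith

theorem exists_abs_cumExcess_le (hf1 : ∀ w z, |f w z| ≤ 1) (hfs1 : ∀ z, |fs z| ≤ 1)
    (h0 : 0 ≤ lam) (x : ℕ → Fin K → Z) (a : ℕ → Fin K) (y : ℕ → ℝ) (t : ℕ) :
    ∃ c, ∀ w, |cumExcess lam f fs x a y t w| ≤ c :=
  ⟨∑ l ∈ Finset.range t, (1 + |y l| + 2 * lam), fun w =>
    (Finset.abs_sum_le_sum_abs _ _).trans
      (Finset.sum_le_sum fun _ _ => abs_excessLoss_le hf1 hfs1 h0 w _ _ _)⟩

variable [MeasurableSpace W] [MeasurableSpace Z]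

theorem measurable_cumExcess {O : Type*} {mO : MeasurableSpace O}
    (hf : Measurable (Function.uncurry f)) (hfs : Measurable fs)
    {X : ℕ → O → Fin K → Z} {A : ℕ → O → Fin K} {Y : ℕ → O → ℝ} {t : ℕ}
    (hX : ∀ l < t, Measurable (X l)) (hA : ∀ l < t, Measurable (A l))
    (hY : ∀ l < t, Measurable (Y l)) :
    Measurable (Function.uncurry fun o w => cumExcess lam f fs (fun l => X l o) (fun l => A l o)
      (fun l => Y l o) t w) := by
  change Measurable fun z : O × W => ∑ l ∈ Finset.range t,
    excessLoss lam f fs z.2 (X l z.1) (A l z.1) (Y l z.1)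
  refine Finset.measurable_sum _ fun l hl => ?_
  rw [Finset.mem_range] at hl
  have hXb : ∀ b, Measurable fun z : O × W => X l z.1 b := fun b =>
    (measurable_pi_apply b).comp ((hX l hl).comp measurable_fst)
  have hXA : Measurable fun z : O × W => X l z.1 (A l z.1) := by
    have h : Measurable fun u : (O × W) × Fin K => X l u.1.1 u.2 :=
      measurable_from_prod_countable_left hXb
    exact h.comp (measurable_id.prodMk ((hA l hl).comp measurable_fst))
  have h1 : Measurable fun z : O × W => f z.2 (X l z.1 (A l z.1)) :=
    hf.comp (measurable_snd.prodMk hXA)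
  have h2 : Measurable fun z : O × W => fs (X l z.1 (A l z.1)) := hfs.comp hXA
  have h3 : Measurable fun z : O × W => Y l z.1 := (hY l hl).comp measurable_fst
  have h4 : Measurable fun z : O × W => ⨆ b, f z.2 (X l z.1 b) :=
    Measurable.iSup fun b => hf.comp (measurable_snd.prodMk (hXb b))
  have h5 : Measurable fun z : O × W => ⨆ b, fs (X l z.1 b) :=
    Measurable.iSup fun b => hfs.comp (hXb b)
  exact ((((h1.sub h3).pow_const 2).sub ((h2.sub h3).pow_const 2)).const_mul _).sub
    ((h4.sub h5).const_mul lam)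

theorem measurable_partitionFun {O : Type*} {mO : MeasurableSpace O} {p₁ : Measure W} [SFinite p₁]
    (hf : Measurable (Function.uncurry f)) (hfs : Measurable fs)
    {X : ℕ → O → Fin K → Z} {A : ℕ → O → Fin K} {Y : ℕ → O → ℝ} {t : ℕ}
    (hX : ∀ l < t, Measurable (X l)) (hA : ∀ l < t, Measurable (A l))
    (hY : ∀ l < t, Measurable (Y l)) :
    Measurable fun o => partitionFun p₁ lam f fs (fun l => X l o) (fun l => A l o)
      (fun l => Y l o) t :=
  (StronglyMeasurable.integral_prod_right (f := fun o w => Real.exp (-cumExcess lam f fs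
    (fun l => X l o) (fun l => A l o) (fun l => Y l o) t w))
    (Real.measurable_exp.comp
      (measurable_cumExcess hf hfs hX hA hY).neg).stronglyMeasurable).measurable

theorem measurable_cumExcess_right (hf : Measurable (Function.uncurry f)) (hfs : Measurable fs)
    (x : ℕ → Fin K → Z) (a : ℕ → Fin K) (y : ℕ → ℝ) (t : ℕ) :
    Measurable (cumExcess lam f fs x a y t) := by
  have h : Measurable (Function.uncurry fun (_ : Unit) (w : W) => cumExcess lam f fs x a y t w) :=
    measurable_cumExcess (X := fun l _ => x l) (A := fun l _ => a l) (Y := fun l _ => y l) hf hfs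
      (fun _ _ => measurable_const) (fun _ _ => measurable_const) (fun _ _ => measurable_const)
  exact h.of_uncurry_left (x := ())

variable {p₁ : Measure W}

theorem integrable_exp_neg_cumExcess [IsProbabilityMeasure p₁]
    (hf : Measurable (Function.uncurry f)) (hfs : Measurable fs)
    (hf1 : ∀ w z, |f w z| ≤ 1) (hfs1 : ∀ z, |fs z| ≤ 1)
    (h0 : 0 ≤ lam) (x : ℕ → Fin K → Z) (a : ℕ → Fin K) (y : ℕ → ℝ) (t : ℕ) :
    Integrable (fun w => Real.exp (-cumExcess lam f fs x a y t w)) p₁ := by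
  obtain ⟨c, hc⟩ := exists_abs_cumExcess_le hf1 hfs1 h0 x a y t
  refine integrable_of_abs_le
    (Real.measurable_exp.comp (measurable_cumExcess_right hf hfs x a y t).neg)
    (c := Real.exp c) fun w => ?_
  rw [abs_of_pos (Real.exp_pos _)]
  exact Real.exp_le_exp.2 (by linarith [(abs_le.1 (hc w)).1])

theorem partitionFun_pos [IsProbabilityMeasure p₁]
    (hf : Measurable (Function.uncurry f)) (hfs : Measurable fs)
    (hf1 : ∀ w z, |f w z| ≤ 1) (hfs1 : ∀ z, |fs z| ≤ 1)
    (h0 : 0 ≤ lam) (x : ℕ → Fin K → Z) (a : ℕ → Fin K) (y : ℕ → ℝ) (t : ℕ) :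
    0 < partitionFun p₁ lam f fs x a y t :=
  integral_exp_pos (integrable_exp_neg_cumExcess hf hfs hf1 hfs1 h0 x a y t)

theorem partitionFun_zero {W Z : Type*} [MeasurableSpace W] {K : ℕ} {p₁ : Measure W}
    [IsProbabilityMeasure p₁] {lam : ℝ} {f : W → Z → ℝ} {fs : Z → ℝ}
    (x : ℕ → Fin K → Z) (a : ℕ → Fin K) (y : ℕ → ℝ) :
    partitionFun p₁ lam f fs x a y 0 = 1 := by
  simp [partitionFun, cumExcess]

/-- The density with respect to `p₁` of the posterior of round `t`. -/
noncomputable def posteriorDensity {W Z : Type*} [MeasurableSpace W] {K : ℕ}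
    (p₁ : Measure W) (lam : ℝ) (f : W → Z → ℝ) (fs : Z → ℝ)
    (x : ℕ → Fin K → Z) (a : ℕ → Fin K) (y : ℕ → ℝ) (t : ℕ) (w : W) : ℝ :=
  Real.exp (-cumExcess lam f fs x a y t w) / partitionFun p₁ lam f fs x a y t

/-- With `g` the reward gap and `ε` the noise, the excess loss of round `t` is `g² / 4 - g ε / 2`
minus the feel-good term, and the ratio of consecutive partition functions is the posterior mean of
`exp (-excess loss)`. -/
theorem partitionFun_succ_div {W Z : Type*} [MeasurableSpace W] {K : ℕ} {p₁ : Measure W}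
    {lam : ℝ} {f : W → Z → ℝ} {fs : Z → ℝ}
    (x : ℕ → Fin K → Z) (a : ℕ → Fin K) (y : ℕ → ℝ) (t : ℕ) :
    partitionFun p₁ lam f fs x a y (t + 1) / partitionFun p₁ lam f fs x a y t
      = ∫ w, posteriorDensity p₁ lam f fs x a y t w
          * Real.exp (-(1 / 4) * (f w (x t (a t)) - fs (x t (a t))) ^ 2
            + 1 / 2 * (f w (x t (a t)) - fs (x t (a t))) * (y t - fs (x t (a t)))
            + lam * ((⨆ b, f w (x t b)) - ⨆ b, fs (x t b))) ∂p₁ := by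
  rw [partitionFun, ← integral_div]
  refine integral_congr_ae (Filter.Eventually.of_forall fun w => ?_)
  simp only [posteriorDensity]
  rw [div_mul_eq_mul_div, ← Real.exp_add]
  congr 2
  simp only [cumExcess, Finset.sum_range_succ, excessLoss]
  ring

/-- The posterior has density `posteriorDensity`. The functions `f` may differ from `linFun φ` on a
`p₁`-null set of parameters, which allows `f` to be bounded and measurable everywhere. -/
theorem posterior_apply {Z : Type*} {K : ℕ} {lam : ℝ}
    {p₁ : Measure (ℕ → ℝ)} [IsProbabilityMeasure p₁] {f : (ℕ → ℝ) → Z → ℝ} {fs : Z → ℝ}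
    {φ : ℕ → Z → ℝ} (hφ : ∀ᵐ w ∂p₁, ∀ z, linFun φ w z = f w z)
    (x : ℕ → Fin K → Z) (a : ℕ → Fin K) (y : ℕ → ℝ) (t : ℕ) (B : Set (ℕ → ℝ)) :
    posterior p₁ (1 / 4) lam φ x a y t B
      = ∫⁻ w in B, ENNReal.ofReal (posteriorDensity p₁ lam f fs x a y t w) ∂p₁ := by
  let c : ℝ := ∑ l ∈ Finset.range t, (lam * (⨆ b, fs (x l b)) - 1 / 4 * (fs (x l (a l)) - y l) ^ 2)
  have hcongr : (fun w => -∑ l ∈ Finset.range t, fgLoss (1 / 4) lam φ w (x l) (a l) (y l))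
      =ᵐ[p₁] fun w => -cumExcess lam f fs x a y t w + c := by
    filter_upwards [hφ] with w hw
    simp only [cumExcess, c, ← Finset.sum_neg_distrib, ← Finset.sum_add_distrib]
    refine Finset.sum_congr rfl fun l _ => ?_
    simp only [fgLoss, maxReward, hw, excessLoss]
    ring
  rw [posterior, tilted_congr hcongr, tilted_apply _ _ _]
  refine lintegral_congr fun w => ?_
  rw [posteriorDensity, partitionFun]
  simp only [Real.exp_add]
  rw [integral_mul_const, mul_div_mul_right _ _ (Real.exp_pos c).ne']

end

/-! ### Summing over the rounds of the interaction -/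

theorem measurable_comp_action {Ω O : Type*} {m : MeasurableSpace Ω} {mO : MeasurableSpace O}
    {K : ℕ} {θ : O → Fin K → ℝ} (hθ : ∀ a, Measurable fun o => θ o a) {π : Ω → O}
    (hπ : Measurable π) {A : Ω → Fin K} (hA : Measurable A) :
    Measurable fun ω => θ (π ω) (A ω) := by
  have h : Measurable fun u : O × Fin K => θ u.1 u.2 := measurable_from_prod_countable_left hθ
  exact h.comp (hπ.prodMk hA)

section History

variable {Ω Z : Type*} [MeasurableSpace Z] {K : ℕ} {X : ℕ → Ω → Fin K → Z} {A : ℕ → Ω → Fin K}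
  {Y : ℕ → Ω → ℝ} {t : ℕ}

theorem comap_le_historyAlg {l : ℕ} (hl : l < t) :
    MeasurableSpace.comap (X l) inferInstance ⊔ MeasurableSpace.comap (A l) inferInstance ⊔
      MeasurableSpace.comap (Y l) inferInstance ≤ historyAlg X A Y t :=
  le_iSup₂_of_le (f := fun l (_ : l ∈ Finset.range t) =>
    MeasurableSpace.comap (X l) inferInstance ⊔ MeasurableSpace.comap (A l) inferInstance ⊔
      MeasurableSpace.comap (Y l) inferInstance) l (Finset.mem_range.2 hl) le_rfl

theorem measurable_preActionAlg_context {l : ℕ} (hl : l ≤ t) :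
    Measurable[preActionAlg X A Y t] (X l) := by
  rcases hl.lt_or_eq with h | rfl
  · exact Measurable.of_comap_le ((le_sup_left.trans le_sup_left).trans
      ((comap_le_historyAlg h).trans le_sup_left))
  · exact Measurable.of_comap_le le_sup_right

theorem measurable_preActionAlg_action {l : ℕ} (hl : l < t) :
    Measurable[preActionAlg X A Y t] (A l) :=
  Measurable.of_comap_le ((le_sup_right.trans le_sup_left).trans
    ((comap_le_historyAlg hl).trans le_sup_left))

theorem measurable_preActionAlg_reward {l : ℕ} (hl : l < t) :
    Measurable[preActionAlg X A Y t] (Y l) :=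
  Measurable.of_comap_le (le_sup_right.trans ((comap_le_historyAlg hl).trans le_sup_left))

theorem preActionAlg_le_preRewardAlg : preActionAlg X A Y t ≤ preRewardAlg X A Y t := le_sup_left

theorem measurable_preRewardAlg_action : Measurable[preRewardAlg X A Y t] (A t) :=
  Measurable.of_comap_le le_sup_right

theorem preRewardAlg_le [mΩ : MeasurableSpace Ω] {P : Measure Ω} {φ : ℕ → Z → ℝ} {wStar : ℕ → ℝ}
    {n : ℕ} (hB : IsBanditInteraction P φ wStar n X A Y) (ht : t < n) :
    preRewardAlg X A Y t ≤ mΩ := by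
  refine sup_le (sup_le (iSup₂_le fun l hl => ?_) (hB.measurable_context t ht).comap_le)
    (hB.measurable_action t ht).comap_le
  have hl : l < n := (Finset.mem_range.1 hl).trans ht
  exact sup_le (sup_le (hB.measurable_context l hl).comap_le (hB.measurable_action l hl).comap_le)
    (hB.measurable_reward l hl).comap_le

end History

theorem measurable_noise {Ω Z : Type*} [MeasurableSpace Ω] [MeasurableSpace Z] {P : Measure Ω}
    {K n : ℕ} {φ : ℕ → Z → ℝ} {wStar : ℕ → ℝ} {X : ℕ → Ω → Fin K → Z} {A : ℕ → Ω → Fin K}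
    {Y : ℕ → Ω → ℝ} (hB : IsBanditInteraction P φ wStar n X A Y)
    (hfs : Measurable (linFun φ wStar)) {t : ℕ} (ht : t < n) :
    Measurable (noise φ wStar X A Y t) := by
  refine (hB.measurable_reward t ht).sub (measurable_comp_action
    (θ := fun (x : Fin K → Z) a => linFun φ wStar (x a))
    (fun a => hfs.comp (measurable_pi_apply a)) (hB.measurable_context t ht)
    (hB.measurable_action t ht))

/-- `round_regret_le` for the interaction protocol. The history space is `Ω` itself with the
σ-algebra `preActionAlg X A Y t`, and `π` is the identity. -/
theorem integrable_and_round_regret_le {Ω Z : Type*} [mΩ : MeasurableSpace Ω] [MeasurableSpace Z]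
    {P : Measure Ω} [IsProbabilityMeasure P] {p₁ : Measure (ℕ → ℝ)} [IsProbabilityMeasure p₁]
    {K n : ℕ} {φ : ℕ → Z → ℝ} {wStar : ℕ → ℝ} {X : ℕ → Ω → Fin K → Z} {A : ℕ → Ω → Fin K}
    {Y : ℕ → Ω → ℝ} {ν : ℕ → Ω → ℕ → ℝ} {lam : ℝ} {f : (ℕ → ℝ) → Z → ℝ}
    (hf : Measurable (Function.uncurry f)) (hf1 : ∀ w z, |f w z| ≤ 1)
    (hφ : ∀ᵐ w ∂p₁, ∀ z, linFun φ w z = f w z)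
    (hfs : Measurable (linFun φ wStar)) (hfs1 : ∀ z, |linFun φ wStar z| ≤ 1)
    (hB : IsBanditInteraction P φ wStar n X A Y)
    (hT : IsFGTS P p₁ (1 / 4) lam φ n X A Y ν)
    (h0 : 0 < lam) (h1 : lam ≤ 1 / 2) {t : ℕ} (ht : t < n) {Zn : ℕ → Ω → ℝ}
    (hZ : ∀ t ω, Zn t ω = partitionFun p₁ lam f (linFun φ wStar) (fun l => X l ω)
      (fun l => A l ω) (fun l => Y l ω) t) :
    Integrable (fun ω => Zn (t + 1) ω / Zn t ω) P ∧
      lam * ∫ ω, (maxReward φ wStar (X t ω) - linFun φ wStar (X t ω (A t ω))) ∂P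
        ≤ lam ^ 2 * (128 / 7 * K + 60) + (1 - ∫ ω, Zn (t + 1) ω / Zn t ω ∂P) := by
  set fs := linFun φ wStar
  have hm1 := preRewardAlg_le hB ht
  have hm0 : preActionAlg X A Y t ≤ mΩ := preActionAlg_le_preRewardAlg.trans hm1
  have hid : @Measurable Ω Ω mΩ (preActionAlg X A Y t) id := measurable_id'' hm0
  have hid1 : @Measurable Ω Ω (preRewardAlg X A Y t) (preActionAlg X A Y t) id :=
    measurable_id'' preActionAlg_le_preRewardAlg
  let q : Ω → (ℕ → ℝ) → ℝ := fun ω => posteriorDensity p₁ lam f fs (fun l => X l ω)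
    (fun l => A l ω) (fun l => Y l ω) t
  have hZpos : ∀ t ω, 0 < Zn t ω := fun t ω => by
    rw [hZ]; exact partitionFun_pos hf hfs hf1 hfs1 h0.le _ _ _ _
  have hS := measurable_cumExcess (mO := preActionAlg X A Y t) (lam := lam) hf hfs
    (fun l (hl : l < t) => measurable_preActionAlg_context (X := X) hl.le)
    (fun l hl => measurable_preActionAlg_action hl)
    (fun l hl => measurable_preActionAlg_reward hl)
  have hE : Measurable[(preActionAlg X A Y t).prod inferInstance]
      fun z : Ω × (ℕ → ℝ) => Real.exp (-cumExcess lam f fs (fun l => X l z.1) (fun l => A l z.1)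
        (fun l => Y l z.1) t z.2) := Real.measurable_exp.comp (Measurable.neg hS)
  have hZt : Measurable[preActionAlg X A Y t] (Zn t) := by
    rw [show Zn t = _ from funext (hZ t)]
    exact measurable_partitionFun (mO := preActionAlg X A Y t) hf hfs
      (fun l (hl : l < t) => measurable_preActionAlg_context (X := X) hl.le)
      (fun l hl => measurable_preActionAlg_action hl)
      (fun l hl => measurable_preActionAlg_reward hl)
  have hq : Measurable[(preActionAlg X A Y t).prod inferInstance] (Function.uncurry q) := by
    have : Function.uncurry q = fun z : Ω × (ℕ → ℝ) => Real.exp (-cumExcess lam f fs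
        (fun l => X l z.1) (fun l => A l z.1) (fun l => Y l z.1) t z.2) / Zn t z.1 := by
      funext z
      simp only [hZ]
      rfl
    rw [this]
    exact Measurable.div hE (hZt.comp measurable_fst)
  have hq0 : ∀ ω w, 0 ≤ q ω w := fun ω w => by
    have := hZpos t ω
    rw [hZ] at this
    exact div_nonneg (Real.exp_pos _).le this.le
  have hqi : ∀ ω, Integrable (q ω) p₁ := fun ω =>
    (integrable_exp_neg_cumExcess hf hfs hf1 hfs1 h0.le _ _ _ _).div_const _
  have hq1 : ∀ ω, ∫ w, q ω w ∂p₁ = 1 := fun ω => by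
    have := hZpos t ω
    rw [hZ] at this
    simp only [q, posteriorDensity]
    rw [integral_div]
    exact div_self this.ne'
  have hpost : ∀ ω (B : Set (ℕ → ℝ)), posterior p₁ (1 / 4) lam φ (fun l => X l ω)
      (fun l => A l ω) (fun l => Y l ω) t B = ∫⁻ w in B, ENNReal.ofReal (q ω w) ∂p₁ :=
    fun ω B => posterior_apply hφ _ _ _ t B
  have hposttop : ∀ ω (B : Set (ℕ → ℝ)), ∫⁻ w in B, ENNReal.ofReal (q ω w) ∂p₁ ≠ ⊤ := fun ω B => by
    rw [← ofReal_integral_eq_lintegral_ofReal (hqi ω).integrableOn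
      (Filter.Eventually.of_forall (hq0 ω))]
    exact ENNReal.ofReal_ne_top
  have hν := hT.measurable_sample t ht
  have hrect : ∀ S B, MeasurableSet[preActionAlg X A Y t] S → MeasurableSet B →
      P (id ⁻¹' S ∩ ν t ⁻¹' B)
        = ∫⁻ ω in id ⁻¹' S, ∫⁻ w in B, ENNReal.ofReal (q (id ω) w) ∂p₁ ∂P := by
    intro S B hS hB'
    have hSm : MeasurableSet S := hm0 S hS
    have hlaw := hT.sample_law t ht B hB'
    have hind : Integrable ((ν t ⁻¹' B).indicator (fun _ => (1 : ℝ))) P :=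
      (integrable_const _).indicator (hν hB')
    have e1 := setIntegral_condExp hm0 hind hS
    rw [setIntegral_congr_ae (g := fun ω => (posterior p₁ (1 / 4) lam φ (fun l => X l ω)
      (fun l => A l ω) (fun l => Y l ω) t).real B) hSm (hlaw.mono fun ω h _ => h),
      setIntegral_indicator (hν hB'), setIntegral_const, smul_eq_mul, mul_one] at e1
    have hi : Integrable (fun ω => (posterior p₁ (1 / 4) lam φ (fun l => X l ω)
      (fun l => A l ω) (fun l => Y l ω) t).real B) P := integrable_condExp.congr hlaw
    calc P (S ∩ ν t ⁻¹' B) = ENNReal.ofReal (P.real (S ∩ ν t ⁻¹' B)) := by simp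
      _ = ∫⁻ ω in S, ENNReal.ofReal ((posterior p₁ (1 / 4) lam φ (fun l => X l ω)
          (fun l => A l ω) (fun l => Y l ω) t).real B) ∂P := by
          rw [← e1, ofReal_integral_eq_lintegral_ofReal hi.integrableOn
            (Filter.Eventually.of_forall fun _ => measureReal_nonneg)]
      _ = _ := by
          refine lintegral_congr fun ω => ?_
          rw [Measure.real, hpost, ENNReal.ofReal_toReal (hposttop ω B)]
          rfl
  have hgreedy : ∀ᵐ ω ∂P, ∀ b, f (ν t ω) (X t (id ω) b) ≤ f (ν t ω) (X t (id ω) (A t ω)) := by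
    have hnull : P (ν t ⁻¹' (toMeasurable p₁ {w | ¬ ∀ z, linFun φ w z = f w z})) = 0 := by
      have := hrect Set.univ _ MeasurableSet.univ
        (measurableSet_toMeasurable p₁ {w | ¬ ∀ z, linFun φ w z = f w z})
      rw [Set.preimage_univ, Set.univ_inter] at this
      rw [this]
      have h0 : p₁ (toMeasurable p₁ {w | ¬ ∀ z, linFun φ w z = f w z}) = 0 := by
        rw [measure_toMeasurable]; exact hφ
      simp only [Measure.restrict_eq_zero.2 h0, lintegral_zero_measure, lintegral_zero]
    have : ∀ᵐ ω ∂P, ∀ z, linFun φ (ν t ω) z = f (ν t ω) z := by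
      refine measure_mono_null (fun ω hω => ?_) hnull
      exact subset_toMeasurable _ _ hω
    filter_upwards [this] with ω hω b
    have := hT.action_greedy t ht ω b
    rwa [hω, hω] at this
  have hε : Measurable (noise φ wStar X A Y t) := measurable_noise hB hfs ht
  have key := round_regret_le (mΩ' := preActionAlg X A Y t) hid hν hq hq0 hqi hq1 hrect
    (hB.measurable_action t ht) (measurable_preActionAlg_context le_rfl) hf hf1 hfs hfs1 hgreedy
    hε (fun θ b hθ hb hθ1 hb0 => lintegral_mul_exp_le_of_condExp_le hm1 hε
      (hB.noise_exp_integrable t ht) (hB.noise_subGaussian t ht)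
      (measurable_comp_action hθ hid1 measurable_preRewardAlg_action)
      (measurable_comp_action hb hid1 measurable_preRewardAlg_action)
      (fun ω => hb0 _ _) (fun ω => hθ1 _ _)) h0 h1
    (R := fun ω => Zn (t + 1) ω / Zn t ω) (fun ω => by
      rw [hZ, hZ, partitionFun_succ_div]
      rfl)
  exact key

/-- The regret bound in terms of the final partition function. Since `1 - r ≤ -log r`, the
quantities `1 - Z (t + 1) / Z t` add up to at most `-log Z n`. A pathwise bound `G` for the latter
spares the integrability of `log Z n`. -/
theorem lam_mul_regret_le {Ω Z : Type*} [mΩ : MeasurableSpace Ω] [MeasurableSpace Z]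
    {P : Measure Ω} [IsProbabilityMeasure P] {p₁ : Measure (ℕ → ℝ)} [IsProbabilityMeasure p₁]
    {K n : ℕ} {φ : ℕ → Z → ℝ} {wStar : ℕ → ℝ} {X : ℕ → Ω → Fin K → Z} {A : ℕ → Ω → Fin K}
    {Y : ℕ → Ω → ℝ} {ν : ℕ → Ω → ℕ → ℝ} {lam : ℝ} {f : (ℕ → ℝ) → Z → ℝ}
    (hf : Measurable (Function.uncurry f)) (hf1 : ∀ w z, |f w z| ≤ 1)
    (hφ : ∀ᵐ w ∂p₁, ∀ z, linFun φ w z = f w z)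
    (hfs : Measurable (linFun φ wStar)) (hfs1 : ∀ z, |linFun φ wStar z| ≤ 1)
    (hB : IsBanditInteraction P φ wStar n X A Y)
    (hT : IsFGTS P p₁ (1 / 4) lam φ n X A Y ν)
    (h0 : 0 < lam) (h1 : lam ≤ 1 / 2) {G : Ω → ℝ} (hG : Integrable G P)
    (hGZ : ∀ ω, -Real.log (partitionFun p₁ lam f (linFun φ wStar) (fun l => X l ω)
      (fun l => A l ω) (fun l => Y l ω) n) ≤ G ω) :
    lam * regret P φ wStar n X A
      ≤ n * (lam ^ 2 * (128 / 7 * K + 60)) + ∫ ω, G ω ∂P := by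
  let Zn : ℕ → Ω → ℝ := fun t ω => partitionFun p₁ lam f (linFun φ wStar) (fun l => X l ω)
      (fun l => A l ω) (fun l => Y l ω) t
  have hZpos : ∀ t ω, 0 < Zn t ω := fun t ω => partitionFun_pos hf hfs hf1 hfs1 h0.le _ _ _ _
  have hround := fun t (ht : t < n) => integrable_and_round_regret_le hf hf1 hφ hfs hfs1 hB hT h0 h1
    ht (Zn := Zn) (fun _ _ => rfl)
  have hreg : regret P φ wStar n X A = ∑ t ∈ Finset.range n,
      ∫ ω, (maxReward φ wStar (X t ω) - linFun φ wStar (X t ω (A t ω))) ∂P := by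
    refine integral_finsetSum _ fun t ht => ?_
    rw [Finset.mem_range] at ht
    have hx := hB.measurable_context t ht
    refine integrable_of_abs_le (c := 2) (Measurable.sub ?_ ?_) fun ω => ?_
    · exact Measurable.iSup fun a => hfs.comp ((measurable_pi_apply a).comp hx)
    · exact measurable_comp_action (θ := fun (x : Fin K → Z) a => linFun φ wStar (x a))
        (fun a => hfs.comp (measurable_pi_apply a)) hx (hB.measurable_action t ht)
    · have e2 := abs_iSup_le_one (u := fun a => linFun φ wStar (X t ω a)) fun a => hfs1 _
      refine (abs_sub _ _).trans ?_
      have := hfs1 (X t ω (A t ω))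
      rw [maxReward]
      linarith
  have hsum : ∑ t ∈ Finset.range n, (1 - ∫ ω, Zn (t + 1) ω / Zn t ω ∂P) ≤ ∫ ω, G ω ∂P := by
    have e : ∀ t ∈ Finset.range n, 1 - ∫ ω, Zn (t + 1) ω / Zn t ω ∂P
        = ∫ ω, (1 - Zn (t + 1) ω / Zn t ω) ∂P := fun t ht => by
      rw [integral_sub (integrable_const _) (hround t (Finset.mem_range.1 ht)).1]
      simp
    have hi : ∀ t ∈ Finset.range n, Integrable (fun ω => 1 - Zn (t + 1) ω / Zn t ω) P :=
      fun t ht => (integrable_const _).sub (hround t (Finset.mem_range.1 ht)).1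
    rw [Finset.sum_congr rfl e, ← integral_finsetSum _ hi]
    refine integral_mono (integrable_finsetSum _ hi) hG fun ω => ?_
    refine le_trans ?_ (hGZ ω)
    calc ∑ t ∈ Finset.range n, (1 - Zn (t + 1) ω / Zn t ω)
        ≤ ∑ t ∈ Finset.range n, (Real.log (Zn t ω) - Real.log (Zn (t + 1) ω)) := by
          refine Finset.sum_le_sum fun t _ => ?_
          have := Real.log_le_sub_one_of_pos (div_pos (hZpos (t + 1) ω) (hZpos t ω))
          rw [Real.log_div (hZpos _ ω).ne' (hZpos _ ω).ne'] at this
          linarith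
      _ = Real.log (Zn 0 ω) - Real.log (Zn n ω) := Finset.sum_range_sub' _ _
      _ = -Real.log (Zn n ω) := by
          have : Zn 0 ω = 1 := partitionFun_zero _ _ _
          rw [this, Real.log_one, zero_sub]
  rw [hreg, Finset.mul_sum]
  calc _ ≤ ∑ t ∈ Finset.range n, (lam ^ 2 * (128 / 7 * (K : ℝ) + 60)
        + (1 - ∫ ω, Zn (t + 1) ω / Zn t ω ∂P)) :=
        Finset.sum_le_sum fun t ht => (hround t (Finset.mem_range.1 ht)).2
    _ ≤ _ := by
        rw [Finset.sum_add_distrib, Finset.sum_const, Finset.card_range, nsmul_eq_mul]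
        linarith

/-! ### The subset-selection prior -/

theorem sum_half_pow_le_one (d : ℕ) : ∑ m ∈ Finset.Icc 1 d, (2⁻¹ : ℝ) ^ m ≤ 1 := by
  have h : ∀ d : ℕ, ∑ m ∈ Finset.Icc 1 d, (2⁻¹ : ℝ) ^ m = 1 - (2⁻¹ : ℝ) ^ d := by
    intro d
    induction d with
    | zero => simp
    | succ k ih =>
      rw [Finset.sum_Icc_succ_top (by omega), ih, pow_succ]
      ring
  rw [h]
  linarith [pow_pos (by norm_num : (0 : ℝ) < 2⁻¹) d]

theorem sum_half_pow_pos {d : ℕ} (hd : 1 ≤ d) : 0 < ∑ m ∈ Finset.Icc 1 d, (2⁻¹ : ℝ) ^ m :=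
  Finset.sum_pos (fun _ _ => by positivity) ⟨1, Finset.mem_Icc.2 ⟨le_rfl, hd⟩⟩

theorem supportProb_nonneg (d : ℕ) (M : Finset ℕ) : 0 ≤ supportProb d M := by
  unfold supportProb
  split_ifs
  · have : 0 ≤ ∑ m ∈ Finset.Icc 1 d, (2⁻¹ : ℝ) ^ m := Finset.sum_nonneg fun _ _ => by positivity
    positivity
  · exact le_rfl

theorem sum_supportProb {d : ℕ} (hd : 1 ≤ d) :
    ∑ M ∈ (Finset.range d).powerset, supportProb d M = 1 := by
  let F : ℕ → ℝ := fun m => if m = 0 then 0 else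
    (2⁻¹ : ℝ) ^ m / ((d.choose m : ℝ) * ∑ m ∈ Finset.Icc 1 d, (2⁻¹ : ℝ) ^ m)
  have h1 : ∀ M ∈ (Finset.range d).powerset, supportProb d M = F M.card := by
    intro M hM
    rw [Finset.mem_powerset] at hM
    rcases M.eq_empty_or_nonempty with rfl | h
    · simp [supportProb, F]
    · simp [supportProb, F, h, hM, h.ne_empty]
  rw [Finset.sum_congr rfl h1, Finset.sum_powerset_apply_card, Finset.card_range,
    Finset.range_eq_Ico, Finset.sum_eq_sum_Ico_succ_bot (by omega)]
  have h2 : ∀ m ∈ Finset.Ico (0 + 1) (d + 1), d.choose m • F m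
      = (2⁻¹ : ℝ) ^ m / ∑ m ∈ Finset.Icc 1 d, (2⁻¹ : ℝ) ^ m := by
    intro m hm
    rw [Finset.mem_Ico] at hm
    have h3 : (0 : ℝ) < d.choose m := by exact_mod_cast Nat.choose_pos (by omega)
    have h4 := sum_half_pow_pos hd
    simp only [F, if_neg (show m ≠ 0 by omega), nsmul_eq_mul]
    field_simp
  rw [Finset.sum_congr rfl h2, ← Finset.sum_div]
  have h5 : Finset.Ico (0 + 1) (d + 1) = Finset.Icc 1 d := by ext; simp
  rw [h5, div_self (sum_half_pow_pos hd).ne']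
  simp [F]

theorem pow_le_supportProb {d : ℕ} {M : Finset ℕ} (hM : M.Nonempty)
    (hMd : M ⊆ Finset.range d) : (1 / (2 * d : ℝ)) ^ M.card ≤ supportProb d M := by
  have hcard : M.card ≤ d := by simpa using Finset.card_le_card hMd
  have hd : 1 ≤ d := hM.card_pos.trans_le hcard
  have h1 : (0 : ℝ) < d.choose M.card := by exact_mod_cast Nat.choose_pos hcard
  have h2 : (d.choose M.card : ℝ) ≤ (d : ℝ) ^ M.card := by
    exact_mod_cast Nat.choose_le_pow d M.card
  have h3 := sum_half_pow_pos hd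
  rw [supportProb, if_pos ⟨hM, hMd⟩, one_div, mul_inv, mul_pow, inv_pow (d : ℝ), ← div_eq_mul_inv]
  refine div_le_div_of_nonneg_left (by positivity) (by positivity) ?_
  calc _ ≤ (d.choose M.card : ℝ) * 1 := mul_le_mul_of_nonneg_left (sum_half_pow_le_one d) h1.le
    _ ≤ _ := by rwa [mul_one]

theorem measurable_extendZero (M : Finset ℕ) : Measurable (extendZero M) := by
  refine measurable_pi_lambda _ fun i => ?_
  unfold extendZero
  split_ifs with h
  · exact measurable_pi_apply _
  · exact measurable_const

theorem isClosed_l1Ball (M : Finset ℕ) : IsClosed (l1Ball M) :=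
  isClosed_le (by fun_prop) continuous_const

theorem volume_l1Ball_ne_zero (M : Finset ℕ) : volume (l1Ball M) ≠ 0 := by
  have ho : IsOpen {v : M → ℝ | ∑ i, |v i| < 1} := isOpen_lt (by fun_prop) continuous_const
  have hpos : 0 < volume {v : M → ℝ | ∑ i, |v i| < 1} := ho.measure_pos volume ⟨0, by simp⟩
  exact (hpos.trans_le (measure_mono fun v hv => le_of_lt (show ∑ i, |v i| < 1 from hv))).ne'

theorem volume_l1Ball_ne_top (M : Finset ℕ) : volume (l1Ball M) ≠ ⊤ := by
  have : l1Ball M ⊆ Metric.closedBall 0 1 := fun v hv => by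
    rw [mem_closedBall_zero_iff, pi_norm_le_iff_of_nonneg zero_le_one]
    intro i
    exact (Finset.single_le_sum (f := fun i => |v i|) (fun _ _ => abs_nonneg _)
      (Finset.mem_univ i)).trans hv
  exact ((measure_mono this).trans_lt Metric.isBounded_closedBall.measure_lt_top).ne

instance isProbabilityMeasure_uniformOnBall (M : Finset ℕ) :
    IsProbabilityMeasure (uniformOnBall M) := by
  have := ProbabilityTheory.cond_isProbabilityMeasure_of_finite (volume_l1Ball_ne_zero M)
    (volume_l1Ball_ne_top M)
  exact Measure.isProbabilityMeasure_map (measurable_extendZero M).aemeasurable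

theorem sparsityPrior_apply (d : ℕ) (B : Set (ℕ → ℝ)) :
    sparsityPrior d B = ∑ M ∈ (Finset.range d).powerset,
      ENNReal.ofReal (supportProb d M) * uniformOnBall M B := by
  simp [sparsityPrior, Measure.finsetSum_apply]

theorem isProbabilityMeasure_sparsityPrior {d : ℕ} (hd : 1 ≤ d) :
    IsProbabilityMeasure (sparsityPrior d) := by
  refine ⟨?_⟩
  rw [sparsityPrior_apply]
  simp only [measure_univ, mul_one]
  rw [← ENNReal.ofReal_sum_of_nonneg fun M _ => supportProb_nonneg d M, sum_supportProb hd,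
    ENNReal.ofReal_one]

/-- A sum over the first `d` coordinates of `extendZero M v`, reduced to the coordinates in `M`. -/
theorem sum_extendZero {M : Finset ℕ} {d : ℕ} (hM : M ⊆ Finset.range d) (v : M → ℝ)
    {g : ℕ → ℝ → ℝ} (hg : ∀ i, i ∉ M → g i 0 = 0) :
    ∑ i ∈ Finset.range d, g i (extendZero M v i) = ∑ i : M, g i (v i) := by
  rw [← Finset.sum_subset hM fun i _ hi => by simp [extendZero, hi, hg i hi], ← Finset.sum_coe_sort]
  refine Finset.sum_congr rfl fun i _ => ?_
  simp [extendZero]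

theorem ae_sparsityPrior (d : ℕ) :
    ∀ᵐ w ∂(sparsityPrior d), ∑ i ∈ Finset.range d, |w i| ≤ 1 ∧ ∀ i, d ≤ i → w i = 0 := by
  rw [ae_iff, sparsityPrior_apply]
  refine Finset.sum_eq_zero fun M hM => ?_
  rw [Finset.mem_powerset] at hM
  have hmeas : MeasurableSet
      {w : ℕ → ℝ | ∑ i ∈ Finset.range d, |w i| ≤ 1 ∧ ∀ i, d ≤ i → w i = 0} := by
    have : {w : ℕ → ℝ | ∑ i ∈ Finset.range d, |w i| ≤ 1 ∧ ∀ i, d ≤ i → w i = 0}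
        = {w | ∑ i ∈ Finset.range d, |w i| ≤ 1} ∩ ⋂ i, ⋂ (_ : d ≤ i), {w | w i = 0} := by
      ext w
      simp
    rw [this]
    exact (measurableSet_le (by fun_prop) measurable_const).inter
      (MeasurableSet.iInter fun i => MeasurableSet.iInter fun _ =>
        measurableSet_eq_fun (measurable_pi_apply i) measurable_const)
  have : ∀ᵐ w ∂(uniformOnBall M),
      ∑ i ∈ Finset.range d, |w i| ≤ 1 ∧ ∀ i, d ≤ i → w i = 0 := by
    rw [uniformOnBall, ae_map_iff (measurable_extendZero M).aemeasurable hmeas]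
    filter_upwards [ProbabilityTheory.ae_cond_mem (μ := volume) (isClosed_l1Ball M).measurableSet]
      with v hv
    refine ⟨?_, fun i hi => ?_⟩
    · rw [sum_extendZero hM v (g := fun _ r => |r|) (by simp)]
      exact hv
    · have : i ∉ M := fun h => by have := Finset.mem_range.1 (hM h); omega
      simp [extendZero, this]
  rw [show uniformOnBall M {w | ¬ (∑ i ∈ Finset.range d, |w i| ≤ 1 ∧ ∀ i, d ≤ i → w i = 0)} = 0
    from this, mul_zero]

/-- The uniform distribution on the `ℓ¹` ball charges an `ℓ¹` neighbourhood of radius `2 ρ` of any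
of its points `v` with at least `ρ ^ |M|`: the neighbourhood contains the image of the ball under
the homothety with centre `v` and ratio `ρ`. -/
theorem pow_le_uniformOnBall {d : ℕ} {M : Finset ℕ} (hM : M ⊆ Finset.range d) {v : ℕ → ℝ}
    (hv : ∀ i, i ∉ M → v i = 0) (hv1 : ∑ i ∈ Finset.range d, |v i| ≤ 1) {ρ : ℝ} (h0 : 0 < ρ)
    (h1 : ρ ≤ 1) :
    ENNReal.ofReal (ρ ^ M.card)
      ≤ uniformOnBall M {w | ∑ i ∈ Finset.range d, |w i - v i| ≤ 2 * ρ} := by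
  have hB : MeasurableSet {w : ℕ → ℝ | ∑ i ∈ Finset.range d, |w i - v i| ≤ 2 * ρ} :=
    measurableSet_le (by fun_prop) measurable_const
  let c : M → ℝ := fun i => v i
  have hc : ∑ i, |c i| ≤ 1 := by
    rw [← Finset.sum_subset hM fun i _ hi => by simp [hv i hi], ← Finset.sum_coe_sort] at hv1
    exact hv1
  let S : Set (M → ℝ) := AffineMap.homothety c ρ '' l1Ball M
  have hS1 : S ⊆ l1Ball M ∩ extendZero M ⁻¹' {w | ∑ i ∈ Finset.range d, |w i - v i| ≤ 2 * ρ} := by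
    rintro _ ⟨u, hu, rfl⟩
    have hu' : ∑ i, |u i| ≤ 1 := hu
    have e : ∀ i, AffineMap.homothety c ρ u i = ρ * (u i - c i) + c i := fun i => by
      simp [AffineMap.homothety_apply]
    constructor
    · change ∑ i, |AffineMap.homothety c ρ u i| ≤ 1
      calc ∑ i, |AffineMap.homothety c ρ u i| ≤ ∑ i, (ρ * |u i| + (1 - ρ) * |c i|) := by
            refine Finset.sum_le_sum fun i _ => ?_
            rw [e, show ρ * (u i - c i) + c i = ρ * u i + (1 - ρ) * c i by ring]
            refine (abs_add_le _ _).trans ?_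
            rw [abs_mul, abs_mul, abs_of_pos h0, abs_of_nonneg (by linarith : 0 ≤ 1 - ρ)]
        _ = ρ * ∑ i, |u i| + (1 - ρ) * ∑ i, |c i| := by
            rw [Finset.sum_add_distrib, Finset.mul_sum, Finset.mul_sum]
        _ ≤ 1 := by nlinarith
    · change ∑ i ∈ Finset.range d, |extendZero M (AffineMap.homothety c ρ u) i - v i| ≤ 2 * ρ
      rw [sum_extendZero hM _ (g := fun i r => |r - v i|) (fun i hi => by simp [hv i hi])]
      calc ∑ i : M, |AffineMap.homothety c ρ u i - v i| ≤ ∑ i, (ρ * |u i| + ρ * |c i|) := by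
            refine Finset.sum_le_sum fun i _ => ?_
            rw [e, show ρ * (u i - c i) + c i - v i = ρ * u i - ρ * c i by simp only [c]; ring]
            refine (abs_sub _ _).trans ?_
            rw [abs_mul, abs_mul, abs_of_pos h0]
        _ = ρ * ∑ i, |u i| + ρ * ∑ i, |c i| := by
            rw [Finset.sum_add_distrib, Finset.mul_sum, Finset.mul_sum]
        _ ≤ 2 * ρ := by nlinarith
  rw [uniformOnBall, Measure.map_apply (measurable_extendZero M) hB,
    ProbabilityTheory.cond_apply (isClosed_l1Ball M).measurableSet]
  calc ENNReal.ofReal (ρ ^ M.card) = (volume (l1Ball M))⁻¹ * volume S := by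
        rw [Measure.addHaar_image_homothety, Module.finrank_fintype_fun_eq_card, Fintype.card_coe,
          abs_of_pos (by positivity), mul_left_comm,
          ENNReal.inv_mul_cancel (volume_l1Ball_ne_zero M) (volume_l1Ball_ne_top M), mul_one]
    _ ≤ _ := mul_le_mul_right (measure_mono hS1) _

theorem pow_le_sparsityPrior {d : ℕ} {M : Finset ℕ} (hM0 : M.Nonempty) (hM : M ⊆ Finset.range d)
    {v : ℕ → ℝ} (hv : ∀ i, i ∉ M → v i = 0) (hv1 : ∑ i ∈ Finset.range d, |v i| ≤ 1) {ρ : ℝ}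
    (h0 : 0 < ρ) (h1 : ρ ≤ 1) :
    ENNReal.ofReal ((ρ / (2 * d)) ^ M.card)
      ≤ sparsityPrior d {w | ∑ i ∈ Finset.range d, |w i - v i| ≤ 2 * ρ} := by
  rw [sparsityPrior_apply]
  refine le_trans ?_ (Finset.single_le_sum (fun _ _ => zero_le) (Finset.mem_powerset.2 hM))
  calc ENNReal.ofReal ((ρ / (2 * d)) ^ M.card)
      = ENNReal.ofReal ((1 / (2 * d : ℝ)) ^ M.card) * ENNReal.ofReal (ρ ^ M.card) := by
        rw [← ENNReal.ofReal_mul (by positivity), ← mul_pow, one_div_mul_eq_div]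
    _ ≤ _ := mul_le_mul' (ENNReal.ofReal_le_ofReal (pow_le_supportProb hM0 hM))
        (pow_le_uniformOnBall hM hv hv1 h0 h1)

/-! ### Feature decay and effective dimension -/

section Decay

variable {Z : Type*} {φ : ℕ → Z → ℝ} {β : ℝ} {n : ℕ}

theorem SparseBandit.PolynomialDecay.abs_le_one (h : PolynomialDecay β φ) (i : ℕ) (z : Z) :
    |φ i z| ≤ 1 :=
  (h.2 i z).trans (Real.rpow_le_one_of_one_le_of_nonpos
    (by linarith [(Nat.cast_nonneg i : (0 : ℝ) ≤ i)]) (by linarith [h.1]))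

theorem SparseBandit.ExponentialDecay.abs_le_one (h : ExponentialDecay β φ) (i : ℕ) (z : Z) :
    |φ i z| ≤ 1 := by
  refine (h.2 i z).trans (Real.exp_le_one_iff.2 ?_)
  have : (0 : ℝ) ≤ ((i : ℝ) + 1) ^ β := by positivity
  linarith

theorem SparseBandit.PolynomialDecay.mem_effDim_set (h : PolynomialDecay β φ) (hn : 1 ≤ n) :
    n ∈ {d : ℕ | 1 ≤ d ∧ ∀ j, d ≤ j → ∀ z, (φ j z) ^ 2 ≤ 1 / (n : ℝ)} := by
  refine ⟨hn, fun j hj z => ?_⟩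
  have hn' : (0 : ℝ) < n := by exact_mod_cast hn
  have hj' : (n : ℝ) ≤ (j : ℝ) + 1 := by
    have : (n : ℝ) ≤ j := by exact_mod_cast hj
    linarith
  have hj1 : (1 : ℝ) ≤ (j : ℝ) + 1 := by linarith [(Nat.cast_nonneg j : (0 : ℝ) ≤ j)]
  calc (φ j z) ^ 2 = |φ j z| ^ 2 := (sq_abs _).symm
    _ ≤ (((j : ℝ) + 1) ^ (-β / 2)) ^ 2 := pow_le_pow_left₀ (abs_nonneg _) (h.2 j z) 2
    _ = ((j : ℝ) + 1) ^ (-β) := by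
        rw [← Real.rpow_natCast, ← Real.rpow_mul (by linarith)]
        congr 1
        push_cast
        ring
    _ ≤ ((j : ℝ) + 1) ^ (-1 : ℝ) := Real.rpow_le_rpow_of_exponent_le hj1 (by linarith [h.1])
    _ = 1 / ((j : ℝ) + 1) := by rw [Real.rpow_neg_one, one_div]
    _ ≤ 1 / (n : ℝ) := one_div_le_one_div_of_le hn' hj'

theorem SparseBandit.ExponentialDecay.mem_effDim_set (h : ExponentialDecay β φ) (hn : 1 ≤ n) :
    max 1 ⌈Real.log n ^ (1 / β)⌉₊
      ∈ {d : ℕ | 1 ≤ d ∧ ∀ j, d ≤ j → ∀ z, (φ j z) ^ 2 ≤ 1 / (n : ℝ)} := by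
  refine ⟨le_max_left _ _, fun j hj z => ?_⟩
  have hn' : (1 : ℝ) ≤ n := by exact_mod_cast hn
  have hlog : 0 ≤ Real.log n := Real.log_nonneg hn'
  have h1 : Real.log n ^ (1 / β) ≤ (j : ℝ) + 1 := by
    have : (⌈Real.log n ^ (1 / β)⌉₊ : ℝ) ≤ j := by exact_mod_cast (le_max_right _ _).trans hj
    linarith [Nat.le_ceil (Real.log n ^ (1 / β))]
  have h2 : Real.log n ≤ ((j : ℝ) + 1) ^ β := by
    have := Real.rpow_le_rpow (by positivity) h1 h.1.le
    rwa [← Real.rpow_mul hlog, one_div_mul_cancel h.1.ne', Real.rpow_one] at this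
  calc (φ j z) ^ 2 = |φ j z| ^ 2 := (sq_abs _).symm
    _ ≤ (Real.exp (-((j : ℝ) + 1) ^ β / 2)) ^ 2 := pow_le_pow_left₀ (abs_nonneg _) (h.2 j z) 2
    _ = Real.exp (-((j : ℝ) + 1) ^ β) := by
        rw [← Real.exp_nat_mul]
        congr 1
        push_cast
        ring
    _ ≤ Real.exp (-Real.log n) := Real.exp_le_exp.2 (by linarith)
    _ = 1 / (n : ℝ) := by rw [Real.exp_neg, Real.exp_log (by linarith), one_div]

theorem abs_le_one_of_decay (h : (∃ β, PolynomialDecay β φ) ∨ ∃ β, ExponentialDecay β φ)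
    (i : ℕ) (z : Z) : |φ i z| ≤ 1 := by
  rcases h with ⟨β, h⟩ | ⟨β, h⟩
  · exact h.abs_le_one i z
  · exact h.abs_le_one i z

theorem effDim_mem_of_decay (h : (∃ β, PolynomialDecay β φ) ∨ ∃ β, ExponentialDecay β φ)
    (hn : 1 ≤ n) : 1 ≤ effDim φ n ∧ ∀ j, effDim φ n ≤ j → ∀ z, (φ j z) ^ 2 ≤ 1 / (n : ℝ) := by
  have : {d : ℕ | 1 ≤ d ∧ ∀ j, d ≤ j → ∀ z, (φ j z) ^ 2 ≤ 1 / (n : ℝ)}.Nonempty := by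
    rcases h with ⟨β, h⟩ | ⟨β, h⟩
    · exact ⟨_, h.mem_effDim_set hn⟩
    · exact ⟨_, h.mem_effDim_set hn⟩
  exact Nat.sInf_mem this

theorem SparseBandit.PolynomialDecay.log_effDim_mul_le (h : PolynomialDecay β φ) (hn : 1 ≤ n) :
    Real.log (effDim φ n * n) ≤ 2 * Real.log n := by
  have hd : effDim φ n ≤ n := Nat.sInf_le (h.mem_effDim_set hn)
  have hd1 : (1 : ℝ) ≤ effDim φ n := by
    exact_mod_cast (effDim_mem_of_decay (Or.inl ⟨β, h⟩) hn).1
  have hn' : (1 : ℝ) ≤ n := by exact_mod_cast hn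
  rw [Real.log_mul (by linarith) (by linarith)]
  have := Real.log_le_log (by linarith) (show (effDim φ n : ℝ) ≤ n by exact_mod_cast hd)
  linarith

theorem SparseBandit.ExponentialDecay.log_effDim_mul_le (h : ExponentialDecay β φ) (hn : 2 ≤ n) :
    Real.log (effDim φ n * n) ≤ 3 * (max 1 (1 / β) * Real.log n) := by
  have hd : effDim φ n ≤ max 1 ⌈Real.log n ^ (1 / β)⌉₊ :=
    Nat.sInf_le (h.mem_effDim_set (by omega))
  have hd1 : (1 : ℝ) ≤ effDim φ n := by
    exact_mod_cast (effDim_mem_of_decay (Or.inr ⟨β, h⟩) (show 1 ≤ n by omega)).1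
  have hn' : (2 : ℝ) ≤ n := by exact_mod_cast hn
  have hlog : 0 < Real.log n := Real.log_pos (by linarith)
  have hm1 := mul_le_mul_of_nonneg_right (le_max_left 1 (1 / β)) hlog.le
  have hm2 := mul_le_mul_of_nonneg_right (le_max_right 1 (1 / β)) hlog.le
  rw [Real.log_mul (by linarith) (by linarith)]
  rcases le_total (Real.log n) 1 with hl | hl
  · have h1 : Real.log n ^ (1 / β) ≤ 1 :=
      Real.rpow_le_one hlog.le hl (one_div_nonneg.2 h.1.le)
    have h2 : max 1 ⌈Real.log n ^ (1 / β)⌉₊ = 1 := max_eq_left (Nat.ceil_le.2 (by simpa using h1))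
    have h3 : (effDim φ n : ℝ) ≤ 1 := by exact_mod_cast hd.trans h2.le
    have := Real.log_le_log (by linarith) h3
    rw [Real.log_one] at this
    linarith
  · have hu : 1 ≤ Real.log n ^ (1 / β) := Real.one_le_rpow hl (one_div_nonneg.2 h.1.le)
    have h1 : (effDim φ n : ℝ) ≤ 2 * Real.log n ^ (1 / β) := by
      have h2 : (effDim φ n : ℝ) ≤ max 1 (⌈Real.log n ^ (1 / β)⌉₊ : ℝ) := by exact_mod_cast hd
      refine h2.trans (max_le (by linarith) ?_)
      linarith [Nat.ceil_lt_add_one (show 0 ≤ Real.log n ^ (1 / β) by linarith)]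
    have h2 := Real.log_le_log (by linarith) h1
    rw [Real.log_mul (by norm_num) (by linarith), Real.log_rpow hlog] at h2
    have h3 : Real.log 2 ≤ Real.log n := Real.log_le_log (by norm_num) hn'
    have h4 : Real.log (Real.log n) ≤ Real.log n := by
      linarith [Real.log_le_sub_one_of_pos hlog]
    have h5 := mul_le_mul_of_nonneg_left h4 (one_div_nonneg.2 h.1.le)
    linarith

end Decay

/-! ### Reward functions of sparse parameters -/

section Features

variable {Z : Type*} {φ : ℕ → Z → ℝ}

/-- The reward function of `w` restricted to the first `d` features and clipped to `[-1, 1]`. Unlike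
`linFun φ w`, a series that need not converge, it is bounded and jointly measurable; the two agree
almost surely under the prior. -/
noncomputable def clippedFun (φ : ℕ → Z → ℝ) (d : ℕ) (w : ℕ → ℝ) (z : Z) : ℝ :=
  max (-1) (min 1 (∑ i ∈ Finset.range d, w i * φ i z))

theorem abs_clippedFun_le_one (d : ℕ) (w : ℕ → ℝ) (z : Z) : |clippedFun φ d w z| ≤ 1 :=
  abs_le.2 ⟨le_max_left _ _, max_le (by norm_num) (min_le_left _ _)⟩

theorem measurable_clippedFun [MeasurableSpace Z] (hφ : ∀ i, Measurable (φ i)) (d : ℕ) :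
    Measurable (Function.uncurry (clippedFun φ d)) := by
  have h : Measurable fun u : (ℕ → ℝ) × Z => ∑ i ∈ Finset.range d, u.1 i * φ i u.2 :=
    Finset.measurable_sum _ fun i _ =>
      ((measurable_pi_apply i).comp measurable_fst).mul ((hφ i).comp measurable_snd)
  exact measurable_const.max (measurable_const.min h)

theorem clippedFun_eq {d : ℕ} {w : ℕ → ℝ} {z : Z} (h : |∑ i ∈ Finset.range d, w i * φ i z| ≤ 1) :
    clippedFun φ d w z = ∑ i ∈ Finset.range d, w i * φ i z := by
  rw [clippedFun, min_eq_right (abs_le.1 h).2, max_eq_right (abs_le.1 h).1]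

theorem abs_sum_mul_le {s : Finset ℕ} {w : ℕ → ℝ} {z : Z} {b : ℝ}
    (hφ : ∀ i ∈ s, |φ i z| ≤ b) :
    |∑ i ∈ s, w i * φ i z| ≤ (∑ i ∈ s, |w i|) * b := by
  rw [Finset.sum_mul]
  refine (Finset.abs_sum_le_sum_abs _ _).trans (Finset.sum_le_sum fun i hi => ?_)
  rw [abs_mul]
  exact mul_le_mul_of_nonneg_left (hφ i hi) (abs_nonneg _)

theorem ae_linFun_eq_clippedFun (hφ : ∀ i z, |φ i z| ≤ 1) (d : ℕ) :
    ∀ᵐ w ∂(sparsityPrior d), ∀ z, linFun φ w z = clippedFun φ d w z := by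
  filter_upwards [ae_sparsityPrior d] with w hw z
  rw [linFun, tsum_eq_sum (s := Finset.range d) fun i hi => by
    rw [hw.2 i (by simpa using hi), zero_mul], clippedFun_eq]
  refine (abs_sum_mul_le fun i _ => hφ i z).trans ?_
  rw [mul_one]
  exact hw.1

theorem abs_clippedFun_sub_le (hφ : ∀ i z, |φ i z| ≤ 1) {d : ℕ} {v w : ℕ → ℝ}
    (hv : ∑ i ∈ Finset.range d, |v i| ≤ 1) {δ : ℝ} (hw : ∑ i ∈ Finset.range d, |w i - v i| ≤ δ)
    (z : Z) : |clippedFun φ d w z - ∑ i ∈ Finset.range d, v i * φ i z| ≤ δ := by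
  have hv' : |∑ i ∈ Finset.range d, v i * φ i z| ≤ 1 :=
    (abs_sum_mul_le fun i _ => hφ i z).trans (by rwa [mul_one])
  rw [← clippedFun_eq hv']
  calc |clippedFun φ d w z - clippedFun φ d v z|
      ≤ |∑ i ∈ Finset.range d, w i * φ i z - ∑ i ∈ Finset.range d, v i * φ i z| := by
        refine (abs_max_sub_max_le_max _ _ _ _).trans ?_
        rw [sub_self, abs_zero]
        refine max_le (abs_nonneg _) ((abs_min_sub_min_le_max _ _ _ _).trans ?_)
        rw [sub_self, abs_zero]
        exact max_le (abs_nonneg _) le_rfl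
    _ = |∑ i ∈ Finset.range d, (w i - v i) * φ i z| := by
        rw [← Finset.sum_sub_distrib]
        simp only [sub_mul]
    _ ≤ _ := (abs_sum_mul_le (w := fun i => w i - v i) fun i _ => hφ i z).trans (by rwa [mul_one])

variable {wStar : ℕ → ℝ}

theorem sum_abs_le_one (hfin : (Function.support wStar).Finite) (h1 : ∑' i, |wStar i| ≤ 1)
    (s : Finset ℕ) : ∑ i ∈ s, |wStar i| ≤ 1 := by
  refine le_trans (Summable.sum_le_tsum s (fun _ _ => abs_nonneg _) ?_) h1
  exact summable_of_hasFiniteSupport (hfin.subset fun i hi h => hi (by simp [h]))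

theorem linFun_eq_sum (hfin : (Function.support wStar).Finite) {s : Finset ℕ}
    (hs : hfin.toFinset ⊆ s) (z : Z) : linFun φ wStar z = ∑ i ∈ s, wStar i * φ i z := by
  refine tsum_eq_sum fun i hi => ?_
  have : wStar i = 0 := by
    by_contra h
    exact hi (hs (by simpa using h))
  rw [this, zero_mul]

theorem measurable_linFun [MeasurableSpace Z] (hφ : ∀ i, Measurable (φ i))
    (hfin : (Function.support wStar).Finite) : Measurable (linFun φ wStar) := by
  rw [show linFun φ wStar = fun z => ∑ i ∈ hfin.toFinset, wStar i * φ i z from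
    funext fun z => linFun_eq_sum hfin subset_rfl z]
  exact Finset.measurable_sum _ fun i _ => (hφ i).const_mul _

theorem abs_linFun_le_one (hφ : ∀ i z, |φ i z| ≤ 1) (hfin : (Function.support wStar).Finite)
    (h1 : ∑' i, |wStar i| ≤ 1) (z : Z) : |linFun φ wStar z| ≤ 1 := by
  rw [linFun_eq_sum hfin subset_rfl]
  refine (abs_sum_mul_le fun i _ => hφ i z).trans ?_
  rw [mul_one]
  exact sum_abs_le_one hfin h1 _

/-- Dropping the features beyond `d`, all bounded by `b`, changes the reward function by at most
`b`. -/
theorem abs_sum_range_sub_linFun_le (hfin : (Function.support wStar).Finite)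
    (h1 : ∑' i, |wStar i| ≤ 1) {d : ℕ} {b : ℝ} (hb : 0 ≤ b) {z : Z}
    (hφ : ∀ j, d ≤ j → |φ j z| ≤ b) :
    |∑ i ∈ Finset.range d, wStar i * φ i z - linFun φ wStar z| ≤ b := by
  rw [linFun_eq_sum hfin (s := Finset.range d ∪ hfin.toFinset) Finset.subset_union_right,
    ← Finset.sum_sdiff (Finset.subset_union_left (s₁ := Finset.range d) (s₂ := hfin.toFinset)),
    sub_add_cancel_right, abs_neg]
  refine (abs_sum_mul_le (b := b) fun i hi => hφ i ?_).trans
    (mul_le_of_le_one_left hb (sum_abs_le_one hfin h1 _))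
  have := (Finset.mem_sdiff.1 hi).2
  simpa using this

end Features

theorem abs_iSup_sub_iSup_le {ι : Type*} [Finite ι] {u v : ι → ℝ} {δ : ℝ} (hδ : 0 ≤ δ)
    (h : ∀ i, |u i - v i| ≤ δ) : |(⨆ i, u i) - ⨆ i, v i| ≤ δ := by
  rcases isEmpty_or_nonempty ι with hι | hι
  · simpa [Real.iSup_of_isEmpty] using hδ
  · have hu := (Set.finite_range u).bddAbove
    have hv := (Set.finite_range v).bddAbove
    refine abs_sub_le_iff.2 ⟨sub_le_iff_le_add.2 (ciSup_le fun i => ?_),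
      sub_le_iff_le_add.2 (ciSup_le fun i => ?_)⟩
    · linarith [(abs_le.1 (h i)).2, le_ciSup hv i]
    · linarith [(abs_le.1 (h i)).1, le_ciSup hu i]

/-! ### The noise terms and the bound for a sparse parameter -/

section Noise

variable {Ω Z : Type*} [mΩ : MeasurableSpace Ω] [MeasurableSpace Z] {P : Measure Ω}
  {K n : ℕ} {φ : ℕ → Z → ℝ} {wStar : ℕ → ℝ} {X : ℕ → Ω → Fin K → Z}
  {A : ℕ → Ω → Fin K} {Y : ℕ → Ω → ℝ} {t : ℕ}

theorem abs_le_exp_add_exp (r : ℝ) : |r| ≤ Real.exp (1 * r) + Real.exp (-1 * r) := by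
  have h1 := Real.add_one_le_exp (1 * r)
  have h2 := Real.add_one_le_exp (-1 * r)
  have h3 := Real.exp_pos (1 * r)
  have h4 := Real.exp_pos (-1 * r)
  exact abs_le.2 ⟨by linarith, by linarith⟩

theorem integrable_noise (hB : IsBanditInteraction P φ wStar n X A Y)
    (hfs : Measurable (linFun φ wStar)) (ht : t < n) : Integrable (noise φ wStar X A Y t) P :=
  Integrable.mono' ((hB.noise_exp_integrable t ht 1).add (hB.noise_exp_integrable t ht (-1)))
    (measurable_noise hB hfs ht).aestronglyMeasurable
    (Filter.Eventually.of_forall fun _ => abs_le_exp_add_exp _)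

variable [IsProbabilityMeasure P]

theorem integral_abs_noise_le (hB : IsBanditInteraction P φ wStar n X A Y)
    (hfs : Measurable (linFun φ wStar)) (ht : t < n) :
    ∫ ω, |noise φ wStar X A Y t ω| ∂P ≤ 6 := by
  have hm := preRewardAlg_le hB ht
  have hexp : ∀ θ : ℝ, θ ^ 2 = 1 → ∫ ω, Real.exp (θ * noise φ wStar X A Y t ω) ∂P ≤ 3 := by
    intro θ hθ
    rw [← integral_condExp hm]
    calc _ ≤ ∫ _, Real.exp (θ ^ 2 / 8) ∂P :=
          integral_mono_ae integrable_condExp (integrable_const _) (hB.noise_subGaussian t ht θ)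
      _ = Real.exp (1 / 8) := by simp [hθ]
      _ ≤ Real.exp 1 := Real.exp_le_exp.2 (by norm_num)
      _ ≤ 3 := by linarith [Real.exp_one_lt_d9]
  calc ∫ ω, |noise φ wStar X A Y t ω| ∂P
      ≤ ∫ ω, (Real.exp (1 * noise φ wStar X A Y t ω)
          + Real.exp (-1 * noise φ wStar X A Y t ω)) ∂P :=
        integral_mono (integrable_noise hB hfs ht).abs
          ((hB.noise_exp_integrable t ht 1).add (hB.noise_exp_integrable t ht (-1)))
          fun _ => abs_le_exp_add_exp _
    _ ≤ 6 := by
        rw [integral_add (hB.noise_exp_integrable t ht 1) (hB.noise_exp_integrable t ht (-1))]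
        linarith [hexp 1 (by norm_num), hexp (-1) (by norm_num)]

theorem integrable_and_integral_mul_noise_eq_zero (hB : IsBanditInteraction P φ wStar n X A Y)
    (hfs : Measurable (linFun φ wStar)) (ht : t < n) {g : Z → ℝ} (hg : Measurable g) {c : ℝ}
    (hc : ∀ z, |g z| ≤ c) :
    Integrable (fun ω => g (X t ω (A t ω)) * noise φ wStar X A Y t ω) P ∧
      ∫ ω, g (X t ω (A t ω)) * noise φ wStar X A Y t ω ∂P = 0 := by
  have hm := preRewardAlg_le hB ht
  have hgm : Measurable[preRewardAlg X A Y t] fun ω => g (X t ω (A t ω)) :=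
    measurable_comp_action (θ := fun (x : Fin K → Z) a => g (x a))
      (fun a => hg.comp (measurable_pi_apply a))
      ((measurable_preActionAlg_context le_rfl).mono preActionAlg_le_preRewardAlg le_rfl)
      measurable_preRewardAlg_action
  have hε := integrable_noise hB hfs ht
  have hi : Integrable (fun ω => g (X t ω (A t ω)) * noise φ wStar X A Y t ω) P :=
    hε.bdd_mul (hgm.mono hm le_rfl).aestronglyMeasurable (Filter.Eventually.of_forall fun ω => hc _)
  refine ⟨hi, ?_⟩
  rw [← integral_condExp hm]
  have h1 := condExp_mul_of_stronglyMeasurable_left (μ := P) hgm.stronglyMeasurable hi hε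
  have h2 : P[fun ω => g (X t ω (A t ω)) * noise φ wStar X A Y t ω | preRewardAlg X A Y t]
      =ᵐ[P] 0 := by
    filter_upwards [h1, hB.noise_centred t ht] with ω e1 e2
    refine e1.trans ?_
    simp [e2]
  rw [integral_congr_ae h2]
  simp

theorem regret_le_two_mul {Ω Z : Type*} [MeasurableSpace Ω] {P : Measure Ω}
    [IsProbabilityMeasure P] {K n : ℕ} {φ : ℕ → Z → ℝ} {wStar : ℕ → ℝ} {X : ℕ → Ω → Fin K → Z}
    {A : ℕ → Ω → Fin K} (hfs1 : ∀ z, |linFun φ wStar z| ≤ 1) :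
    regret P φ wStar n X A ≤ 2 * n := by
  refine (le_abs_self _).trans ?_
  have := norm_integral_le_of_norm_le_const (μ := P) (C := 2 * n)
    (f := fun ω => ∑ t ∈ Finset.range n,
      (maxReward φ wStar (X t ω) - linFun φ wStar (X t ω (A t ω))))
    (Filter.Eventually.of_forall fun ω => by
      refine (Finset.abs_sum_le_sum_abs _ _).trans ?_
      refine (Finset.sum_le_card_nsmul _ _ 2 fun t _ => ?_).trans (by simp [mul_comm])
      have e2 := abs_iSup_le_one (u := fun a => linFun φ wStar (X t ω a)) fun a => hfs1 _
      refine (abs_sub _ _).trans ?_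
      have := hfs1 (X t ω (A t ω))
      rw [maxReward]
      linarith)
  rwa [probReal_univ, mul_one] at this

end Noise

/-- The excess loss of a parameter `w` near a reference function `fv` near the truth `fs`. The part
of the noise term that comes from `fv - fs` is kept exactly, because it is centred; an absolute
bound would be too expensive for the truncation error `δ'`, which is only of order `1 / √n`. -/
theorem excessLoss_le_of_abs_le {W Z : Type*} {K : ℕ} {lam : ℝ} {f : W → Z → ℝ} {fs fv : Z → ℝ}
    {w : W} {δ δ' : ℝ} (h0 : 0 ≤ lam) (h1 : ∀ z, |f w z - fv z| ≤ δ)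
    (h2 : ∀ z, |fv z - fs z| ≤ δ') (x : Fin K → Z) (a : Fin K) (y : ℝ) :
    excessLoss lam f fs w x a y ≤ 1 / 4 * (δ + δ') ^ 2 + lam * (δ + δ')
      + 1 / 2 * δ * |y - fs (x a)| - 1 / 2 * ((fv (x a) - fs (x a)) * (y - fs (x a))) := by
  have hg : ∀ z, |f w z - fs z| ≤ δ + δ' := fun z =>
    (abs_sub_le _ (fv z) _).trans (add_le_add (h1 z) (h2 z))
  have hδ : 0 ≤ δ + δ' := (abs_nonneg _).trans (hg (x a))
  have hsup := (abs_le.1 (abs_iSup_sub_iSup_le hδ fun b => hg (x b))).1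
  have hsq : (f w (x a) - fs (x a)) ^ 2 ≤ (δ + δ') ^ 2 :=
    sq_le_sq' (abs_le.1 (hg _)).1 (abs_le.1 (hg _)).2
  have hlin : -((f w (x a) - fv (x a)) * (y - fs (x a))) ≤ δ * |y - fs (x a)| := by
    refine (neg_le_abs _).trans ?_
    rw [abs_mul]
    exact mul_le_mul_of_nonneg_right (h1 _) (abs_nonneg _)
  have hl := mul_le_mul_of_nonneg_left hsup h0
  unfold excessLoss
  nlinarith

/-- The regret bound for a sparse parameter before `lam` is tuned. The partition function is bounded
below by the contribution of an `ℓ¹` neighbourhood of radius `2 / n` of the truncation of `wStar` to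
the first `d` features. -/
theorem lam_mul_regret_le_of_sparse {Ω Z : Type*} [mΩ : MeasurableSpace Ω] [MeasurableSpace Z]
    {P : Measure Ω} [IsProbabilityMeasure P] {K n : ℕ} {φ : ℕ → Z → ℝ} {wStar : ℕ → ℝ}
    {X : ℕ → Ω → Fin K → Z} {A : ℕ → Ω → Fin K} {Y : ℕ → Ω → ℝ} {ν : ℕ → Ω → ℕ → ℝ} {lam : ℝ}
    {d s : ℕ} (hn : 2 ≤ n) (hφ : ∀ i, Measurable (φ i)) (hφ1 : ∀ i z, |φ i z| ≤ 1)
    (hd : 1 ≤ d) (hφd : ∀ j, d ≤ j → ∀ z, (φ j z) ^ 2 ≤ 1 / (n : ℝ))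
    (hfin : (Function.support wStar).Finite) (hw1 : ∑' i, |wStar i| ≤ 1)
    (hs : 1 ≤ s) (hws : l0norm wStar ≤ s) (hK : 1 ≤ K)
    (hB : IsBanditInteraction P φ wStar n X A Y)
    (hT : IsFGTS P (sparsityPrior d) (1 / 4) lam φ n X A Y ν)
    (h0 : 0 < lam) (h1 : lam ≤ 1 / 2) :
    lam * regret P φ wStar n X A
      ≤ 80 * (n * K) * lam ^ 2 + 16 * (s * Real.log (d * n)) + 3 * lam * √n := by
  have := isProbabilityMeasure_sparsityPrior hd
  have hfs := measurable_linFun hφ hfin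
  have hfs1 := abs_linFun_le_one hφ1 hfin hw1
  have hn0 : (0 : ℝ) < n := by exact_mod_cast (by omega : 0 < n)
  have hd0 : (1 : ℝ) ≤ d := by exact_mod_cast hd
  have hn2 : (2 : ℝ) ≤ n := by exact_mod_cast hn
  -- a non-empty `M` that carries the truncation of `wStar` to the first `d` features
  obtain ⟨M, hM0, hMd, hMs, hMw⟩ : ∃ M : Finset ℕ, M.Nonempty ∧ M ⊆ Finset.range d ∧ M.card ≤ s ∧
      ∀ i ∈ Finset.range d, i ∉ M → wStar i = 0 := by
    by_cases h : (hfin.toFinset ∩ Finset.range d).Nonempty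
    · refine ⟨_, h, Finset.inter_subset_right, ?_, fun i hi hiM => ?_⟩
      · refine (Finset.card_le_card Finset.inter_subset_left).trans ?_
        rwa [l0norm, Set.ncard_eq_toFinset_card _ hfin] at hws
      · by_contra hne
        exact hiM (Finset.mem_inter.2 ⟨by simpa using hne, hi⟩)
    · refine ⟨{0}, by simp, by simpa using by omega, by simpa using hs, fun i hi _ => ?_⟩
      by_contra hne
      exact h ⟨i, Finset.mem_inter.2 ⟨by simpa using hne, hi⟩⟩
  let v : ℕ → ℝ := fun i => if i ∈ Finset.range d then wStar i else 0
  have hvd : ∀ i ∈ Finset.range d, v i = wStar i := fun i hi => if_pos hi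
  have hvM : ∀ i, i ∉ M → v i = 0 := fun i hi => by
    by_cases h : i ∈ Finset.range d
    · rw [hvd i h, hMw i h hi]
    · exact if_neg h
  have hv1 : ∑ i ∈ Finset.range d, |v i| ≤ 1 := by
    rw [Finset.sum_congr rfl fun i hi => by rw [hvd i hi]]
    exact sum_abs_le_one hfin hw1 _
  let fv : Z → ℝ := fun z => ∑ i ∈ Finset.range d, v i * φ i z
  have hfvm : Measurable fv := Finset.measurable_sum _ fun i _ => (hφ i).const_mul _
  have hfv : ∀ z, |fv z - linFun φ wStar z| ≤ 1 / √n := fun z => by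
    have e : fv z = ∑ i ∈ Finset.range d, wStar i * φ i z :=
      Finset.sum_congr rfl fun i hi => by rw [hvd i hi]
    rw [e]
    refine abs_sum_range_sub_linFun_le hfin hw1 (by positivity) fun j hj => ?_
    have := Real.abs_le_sqrt (hφd j hj z)
    rwa [Real.sqrt_div' _ hn0.le, Real.sqrt_one] at this
  let B : Set (ℕ → ℝ) := {w | ∑ i ∈ Finset.range d, |w i - v i| ≤ 2 * (1 / (n : ℝ))}
  have hBm : MeasurableSet B := measurableSet_le (by fun_prop) measurable_const
  have hmass : (1 / (n : ℝ) / (2 * d)) ^ M.card ≤ (sparsityPrior d).real B :=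
    (ENNReal.ofReal_le_iff_le_toReal (measure_ne_top _ _)).1
      (pow_le_sparsityPrior hM0 hMd hvM hv1 (by positivity)
        ((div_le_one hn0).2 (by linarith)))
  have hmass0 : 0 < (1 / (n : ℝ) / (2 * d)) ^ M.card := by positivity
  set L := Real.log (d * n) with hL
  have hL2 : Real.log 2 ≤ L := Real.log_le_log (by norm_num) (by nlinarith)
  have hlogmass : -Real.log ((sparsityPrior d).real B) ≤ 2 * (s * L) := by
    have e1 := Real.log_le_log hmass0 hmass
    rw [Real.log_pow, show 1 / (n : ℝ) / (2 * d) = (2 * (d * n : ℝ))⁻¹ by field_simp, Real.log_inv,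
      Real.log_mul (by norm_num) (by positivity), ← hL] at e1
    have hcard : (M.card : ℝ) ≤ s := by exact_mod_cast hMs
    have hL0 : 0 ≤ Real.log 2 := Real.log_nonneg (by norm_num)
    have e2 := mul_le_mul hcard (show Real.log 2 + L ≤ 2 * L by linarith) (by linarith)
      (by positivity)
    linarith
  let ε : ℕ → Ω → ℝ := noise φ wStar X A Y
  let g₀ : Z → ℝ := fun z => fv z - linFun φ wStar z
  have hg₀ : Measurable g₀ := hfvm.sub hfs
  let D : Ω → ℝ := fun ω => ∑ l ∈ Finset.range n, (1 / 4 * (2 * (1 / (n : ℝ)) + 1 / √n) ^ 2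
    + lam * (2 * (1 / (n : ℝ)) + 1 / √n) + 1 / 2 * (2 * (1 / (n : ℝ))) * |ε l ω|
      - 1 / 2 * (g₀ (X l ω (A l ω)) * ε l ω))
  have hexc : ∀ ω, ∀ w ∈ B, cumExcess lam (clippedFun φ d) (linFun φ wStar) (fun l => X l ω)
      (fun l => A l ω) (fun l => Y l ω) n w ≤ D ω := fun ω w hw =>
    Finset.sum_le_sum fun l _ => excessLoss_le_of_abs_le h0.le
      (fun z => abs_clippedFun_sub_le hφ1 hv1 hw z) hfv _ _ _
  have hGZ : ∀ ω, -Real.log (partitionFun (sparsityPrior d) lam (clippedFun φ d) (linFun φ wStar)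
      (fun l => X l ω) (fun l => A l ω) (fun l => Y l ω) n) ≤ 2 * (s * L) + D ω := fun ω => by
    have hint := integrable_exp_neg_cumExcess (p₁ := sparsityPrior d)
      (measurable_clippedFun hφ d) hfs (abs_clippedFun_le_one d) hfs1 h0.le (fun l => X l ω)
      (fun l => A l ω) (fun l => Y l ω) n
    have e1 : (sparsityPrior d).real B * Real.exp (-D ω) ≤ partitionFun (sparsityPrior d) lam
        (clippedFun φ d) (linFun φ wStar) (fun l => X l ω) (fun l => A l ω) (fun l => Y l ω) n := by
      calc (sparsityPrior d).real B * Real.exp (-D ω)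
          = ∫ w in B, Real.exp (-D ω) ∂(sparsityPrior d) := by rw [setIntegral_const, smul_eq_mul]
        _ ≤ ∫ w in B, Real.exp (-cumExcess lam (clippedFun φ d) (linFun φ wStar) (fun l => X l ω)
            (fun l => A l ω) (fun l => Y l ω) n w) ∂(sparsityPrior d) :=
            setIntegral_mono_on integrableOn_const hint.integrableOn hBm
              fun w hw => Real.exp_le_exp.2 (neg_le_neg (hexc ω w hw))
        _ ≤ _ := setIntegral_le_integral hint
            (Filter.Eventually.of_forall fun w => (Real.exp_pos _).le)
    have hB0 : 0 < (sparsityPrior d).real B := hmass0.trans_le hmass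
    have e2 := Real.log_le_log (mul_pos hB0 (Real.exp_pos _)) e1
    rw [Real.log_mul hB0.ne' (Real.exp_pos _).ne', Real.log_exp] at e2
    linarith
  have hεi : ∀ l ∈ Finset.range n, Integrable (fun ω => |ε l ω|) P := fun l hl =>
    (integrable_noise hB hfs (Finset.mem_range.1 hl)).abs
  have hgi := fun l (hl : l ∈ Finset.range n) => integrable_and_integral_mul_noise_eq_zero hB hfs
    (Finset.mem_range.1 hl) hg₀ hfv
  have hDl : ∀ l ∈ Finset.range n, Integrable (fun ω =>
      1 / 4 * (2 * (1 / (n : ℝ)) + 1 / √n) ^ 2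
    + lam * (2 * (1 / (n : ℝ)) + 1 / √n) + 1 / 2 * (2 * (1 / (n : ℝ))) * |ε l ω|
      - 1 / 2 * (g₀ (X l ω (A l ω)) * ε l ω)) P := fun l hl =>
    ((integrable_const _).add ((hεi l hl).const_mul _)).sub ((hgi l hl).1.const_mul _)
  have hDi : Integrable D P := integrable_finsetSum _ hDl
  have hδ : 2 * (1 / (n : ℝ)) + 1 / √n ≤ 3 * (1 / √n) := by
    have hsq : (0 : ℝ) < √n := Real.sqrt_pos.2 hn0
    have h2 : 1 / (n : ℝ) ≤ 1 / √n :=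
      one_div_le_one_div_of_le hsq (Real.sqrt_le_iff.2 ⟨hn0.le, by nlinarith⟩)
    linarith
  have hDint : ∫ ω, D ω ∂P ≤ 9 / 4 + 3 * lam * √n + 6 := by
    have e1 : ∫ ω, D ω ∂P = ∑ l ∈ Finset.range n, (1 / 4 * (2 * (1 / (n : ℝ)) + 1 / √n) ^ 2
        + lam * (2 * (1 / (n : ℝ)) + 1 / √n) + 1 / 2 * (2 * (1 / (n : ℝ))) * ∫ ω, |ε l ω| ∂P) := by
      simp only [D]
      rw [integral_finsetSum _ hDl]
      refine Finset.sum_congr rfl fun l hl => ?_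
      have j1 : Integrable (fun ω => 1 / 4 * (2 * (1 / (n : ℝ)) + 1 / √n) ^ 2
        + lam * (2 * (1 / (n : ℝ)) + 1 / √n) + 1 / 2 * (2 * (1 / (n : ℝ))) * |ε l ω|) P :=
        (integrable_const _).add ((hεi l hl).const_mul _)
      rw [integral_sub j1 ((hgi l hl).1.const_mul _),
        integral_add (integrable_const _) ((hεi l hl).const_mul _), integral_const_mul,
        integral_const_mul, (hgi l hl).2]
      simp
    have hsq : (0 : ℝ) < √n := Real.sqrt_pos.2 hn0
    have hsqn : √(n : ℝ) * √n = n := Real.mul_self_sqrt hn0.le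
    rw [e1]
    calc _ ≤ ∑ l ∈ Finset.range n, (1 / 4 * (3 * (1 / √n)) ^ 2 + lam * (3 * (1 / √n))
          + 1 / 2 * (2 * (1 / (n : ℝ))) * 6) := by
          refine Finset.sum_le_sum fun l hl => ?_
          have h3 := integral_abs_noise_le hB hfs (Finset.mem_range.1 hl)
          gcongr
      _ = 9 / 4 + 3 * lam * √n + 6 := by
          have e2 : ∀ r m : ℝ, 0 < r → r * r = m → m * (1 / 4 * (3 * (1 / r)) ^ 2
              + lam * (3 * (1 / r)) + 1 / 2 * (2 * (1 / m)) * 6) = 9 / 4 + 3 * lam * r + 6 := by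
            rintro r _ hr rfl
            field_simp
            ring
          rw [Finset.sum_const, Finset.card_range, nsmul_eq_mul, e2 _ _ hsq hsqn]
  have main := lam_mul_regret_le (measurable_clippedFun hφ d) (abs_clippedFun_le_one d)
    (ae_linFun_eq_clippedFun hφ1 d) hfs hfs1 hB hT h0 h1
    (G := fun ω => 2 * (s * L) + D ω) ((integrable_const _).add hDi) hGZ
  rw [integral_add (integrable_const _) hDi] at main
  simp only [integral_const, probReal_univ, smul_eq_mul, one_mul] at main
  have hK1 : (1 : ℝ) ≤ K := by exact_mod_cast hK
  have hs1 : (1 : ℝ) ≤ s := by exact_mod_cast hs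
  have hsL : 0.69 ≤ s * L := by
    have := Real.log_two_gt_d9
    nlinarith
  have h4 : n * (lam ^ 2 * (128 / 7 * K + 60)) ≤ 80 * (n * K) * lam ^ 2 := by
    have : n * lam ^ 2 * (128 / 7 * K + 60) ≤ n * lam ^ 2 * (80 * K) :=
      mul_le_mul_of_nonneg_left (by linarith) (by positivity)
    linarith
  linarith

/-- Tuning `lam`. For `lam > 1 / 2` the trivial bound `2 n` suffices, since then `n` is at most a
multiple of `r D`. The unknown-sparsity case is `r = 1`, `τ = s`; the known-sparsity case is
`r = τ = √s`. -/
theorem regret_le_of_tuned_parameter {c₁ c₂ n K L D r s τ lam R : ℝ} (hc₁ : 0 < c₁) (hc₂ : 0 < c₂)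
    (hn : 0 < n) (hK : 1 ≤ K) (hL : 1 / 2 ≤ L) (hD : 0 < D) (hD2 : D ^ 2 = K * n * L) (hr : 1 ≤ r)
    (hτ : r ≤ τ) (hs : s = τ * r)
    (h1 : c₁ * (r * D / (K * n)) ≤ lam) (h2 : lam ≤ c₂ * (r * D / (K * n)))
    (hR : R ≤ 2 * n)
    (hR' : 0 < lam → lam ≤ 1 / 2 →
      lam * R ≤ 80 * (n * K) * lam ^ 2 + 16 * (s * L) + 3 * lam * √n) :
    R ≤ (80 * c₂ + 16 / c₁ + 6) * (τ * D) := by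
  have hK0 : 0 < K := by linarith
  have hτD : 0 < τ * D := mul_pos (by linarith) hD
  have hrD : r * D ≤ τ * D := mul_le_mul_of_nonneg_right hτ hD.le
  have hKn : 0 < K * n := by positivity
  have hpos : 0 < r * D := mul_pos (by linarith) hD
  have hlam0 : 0 < lam := lt_of_lt_of_le (by positivity) h1
  have h2' : K * n * lam ≤ c₂ * (r * D) := by
    have := mul_le_mul_of_nonneg_left h2 hKn.le
    rwa [show K * n * (c₂ * (r * D / (K * n))) = c₂ * (r * D) by field_simp] at this
  have h1' : c₁ * (r * D) ≤ K * n * lam := by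
    have := mul_le_mul_of_nonneg_left h1 hKn.le
    rwa [show K * n * (c₁ * (r * D / (K * n))) = c₁ * (r * D) by field_simp] at this
  have hc1' : 0 < 16 / c₁ := by positivity
  rcases le_or_gt lam (1 / 2) with h | h
  · have h3 := hR' hlam0 h
    have h4 : √n ≤ 2 * D := by
      rw [Real.sqrt_le_left (by positivity)]
      nlinarith [mul_le_mul hK (le_refl n) hn.le hK0.le, mul_le_mul_of_nonneg_left hL hKn.le]
    have h5 : 16 * (s * L) ≤ lam * (16 / c₁ * (τ * D)) := by
      rw [hs, div_mul_eq_mul_div, mul_div_assoc', le_div_iff₀ hc₁]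
      have h6 : 16 * (τ * D) * (c₁ * (r * D)) ≤ 16 * (τ * D) * (K * n * lam) :=
        mul_le_mul_of_nonneg_left h1' (by positivity)
      have h7 : 16 * (τ * D) * (c₁ * (r * D)) = (16 * (τ * r * L) * c₁) * (K * n) := by
        linear_combination (16 * τ * r * c₁) * hD2
      have h8 : (16 * (τ * r * L) * c₁) * (K * n) ≤ (lam * (16 * (τ * D))) * (K * n) := by
        linarith
      exact le_of_mul_le_mul_right h8 hKn
    have h6 : lam * R ≤ lam * ((80 * c₂ + 16 / c₁ + 6) * (τ * D)) := by
      have h7 : 80 * (n * K) * lam ^ 2 ≤ lam * (80 * c₂ * (τ * D)) := by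
        have : K * n * lam ≤ c₂ * (τ * D) := h2'.trans (mul_le_mul_of_nonneg_left hrD hc₂.le)
        nlinarith
      have h8 : 3 * lam * √n ≤ lam * (6 * (τ * D)) := by
        have : √n ≤ 2 * (τ * D) := by nlinarith
        nlinarith
      linarith
    exact le_of_mul_le_mul_left h6 hlam0
  · have h3 : n ≤ K * n := by nlinarith
    have h4 : K * n * (1 / 2) ≤ K * n * lam := mul_le_mul_of_nonneg_left h.le hKn.le
    have h5 := mul_le_mul_of_nonneg_left hrD hc₂.le
    have h6 : 0 < c₂ * (τ * D) := mul_pos hc₂ hτD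
    have h7 : 0 < 16 / c₁ * (τ * D) := mul_pos hc1' hτD
    linarith

/-! ### The two choices of the parameter -/

theorem sqrt_mul_div_eq {σ L m : ℝ} (hσ : 0 ≤ σ) (hm : 0 < m) :
    √(σ * L / m) = √σ * √(m * L) / m := by
  rw [show σ * L / m = σ * (m * L) / m ^ 2 by field_simp, Real.sqrt_div' _ (sq_nonneg m),
    Real.sqrt_sq hm.le, Real.sqrt_mul hσ]

theorem theorem3 (c₁ c₂ : ℝ) (hc₁ : 0 < c₁) (hc₂ : c₁ ≤ c₂) :
    ∃ C : ℝ, 0 < C ∧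
      ∀ (Ω : Type*) [MeasurableSpace Ω] (P : Measure Ω) [IsProbabilityMeasure P]
        (Z : Type*) [MeasurableSpace Z] (K n : ℕ) (φ : ℕ → Z → ℝ) (wStar : ℕ → ℝ)
        (X : ℕ → Ω → Fin K → Z) (A : ℕ → Ω → Fin K) (Y : ℕ → Ω → ℝ) (ν : ℕ → Ω → ℕ → ℝ)
        (lam : ℝ),
        2 ≤ n →
        (∀ i, Measurable (φ i)) →
        ((∃ β, PolynomialDecay β φ) ∨ (∃ β, ExponentialDecay β φ)) →
        (Function.support wStar).Finite →
        ∑' i, |wStar i| ≤ 1 →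
        IsBanditInteraction P φ wStar n X A Y →
        IsFGTS P (sparsityPrior (effDim φ n)) (1 / 4) lam φ n X A Y ν →
        -- unknown sparsity
        (c₁ * √(Real.log (effDim φ n * n) / (K * n)) ≤ lam →
          lam ≤ c₂ * √(Real.log (effDim φ n * n) / (K * n)) →
          regret P φ wStar n X A
            ≤ C * (l0norm wStar * √(K * n * Real.log (effDim φ n * n)))) ∧
        -- known upper bound `s` on the sparsity
        (∀ s : ℕ, l0norm wStar ≤ s →
          c₁ * √(s * Real.log (effDim φ n * n) / (K * n)) ≤ lam →
          lam ≤ c₂ * √(s * Real.log (effDim φ n * n) / (K * n)) →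
          regret P φ wStar n X A ≤ C * √(K * s * n * Real.log (effDim φ n * n)) ∧
          -- comparison with the minimax lower bounds
          (∀ β, PolynomialDecay β φ →
            regret P φ wStar n X A ≤ C * √(Real.log n) * (1 / 8 * √(K * s * n))) ∧
          (∀ β, ExponentialDecay β φ →
            regret P φ wStar n X A
              ≤ C * √(Real.log n) * (1 / 8 * √(max 1 (1 / β) * K * s * n)))) := by
  have hc₂0 : 0 < c₂ := hc₁.trans_le hc₂
  set C₀ : ℝ := 80 * c₂ + 16 / c₁ + 6
  have hC₀pos : 0 < C₀ := by positivity
  refine ⟨16 * C₀, by positivity, ?_⟩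
  intro Ω _ P _ Z _ K n φ wStar X A Y ν lam hn hφ hdecay hfin hw1 hB hT
  have hφ1 := abs_le_one_of_decay hdecay
  have hfs1 := abs_linFun_le_one hφ1 hfin hw1
  obtain ⟨hd1, hφd⟩ := effDim_mem_of_decay hdecay (show 1 ≤ n by omega)
  have hK : 1 ≤ K := by
    obtain ⟨ω⟩ := nonempty_of_isProbabilityMeasure P
    exact (Nat.zero_le _).trans_lt (A 0 ω).isLt
  have hn2 : (2 : ℝ) ≤ n := by exact_mod_cast hn
  have hn0 : (0 : ℝ) < n := by linarith
  have hK1 : (1 : ℝ) ≤ K := by exact_mod_cast hK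
  have hKn : (0 : ℝ) < K * n := by positivity
  set L := Real.log (effDim φ n * n)
  have hL2 : 1 / 2 ≤ L := by
    have h1 : (1 : ℝ) ≤ effDim φ n := by exact_mod_cast hd1
    have h2 : Real.log 2 ≤ L := Real.log_le_log (by norm_num) (by nlinarith)
    linarith [Real.log_two_gt_d9]
  have hD : 0 < √(K * n * L) := Real.sqrt_pos.2 (by positivity)
  have core : ∀ (s : ℕ) (r τ : ℝ), l0norm wStar ≤ s → 1 ≤ r → r ≤ τ → (s : ℝ) = τ * r →
      c₁ * (r * √(K * n * L) / (K * n)) ≤ lam → lam ≤ c₂ * (r * √(K * n * L) / (K * n)) →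
      regret P φ wStar n X A ≤ C₀ * (τ * √(K * n * L)) := by
    intro s r τ hs hr hτ hsr h1 h2
    have hs1 : 1 ≤ s := by
      have : (1 : ℝ) ≤ s := by rw [hsr]; nlinarith
      exact_mod_cast this
    exact regret_le_of_tuned_parameter hc₁ hc₂0 hn0 hK1 hL2 hD (Real.sq_sqrt (by positivity)) hr hτ
      hsr h1 h2 (regret_le_two_mul hfs1) fun h0 h12 =>
        lam_mul_regret_le_of_sparse hn hφ hφ1 hd1 hφd hfin hw1 hs1 hs hK hB hT h0 h12
  -- for `wStar = 0` the right-hand sides vanish, and so does the regret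
  have hzero : l0norm wStar = 0 → regret P φ wStar n X A = 0 := fun h => by
    have hw : wStar = 0 := by
      rw [l0norm, Set.ncard_eq_zero hfin] at h
      exact Function.support_eq_empty_iff.1 h
    simp [regret, maxReward, linFun, hw]
  refine ⟨fun h1 h2 => ?_, fun s hs h1 h2 => ?_⟩
  · rcases Nat.eq_zero_or_pos (l0norm wStar) with h | h
    · rw [hzero h]
      positivity
    · have e := sqrt_mul_div_eq (L := L) zero_le_one hKn
      rw [one_mul, Real.sqrt_one] at e
      rw [e] at h1 h2
      have := core (l0norm wStar) 1 (l0norm wStar) le_rfl le_rfl (by exact_mod_cast h) (by simp)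
        h1 h2
      refine this.trans (mul_le_mul_of_nonneg_right (by linarith) (by positivity))
  · have hreg : regret P φ wStar n X A ≤ C₀ * √(K * s * n * L) := by
      rcases Nat.eq_zero_or_pos s with h | h
      · rw [hzero (by omega)]
        positivity
      · have hs1 : (1 : ℝ) ≤ s := by exact_mod_cast h
        rw [sqrt_mul_div_eq (L := L) (by linarith) hKn] at h1 h2
        have := core s (√s) (√s) hs (Real.one_le_sqrt.2 hs1) le_rfl
          (Real.mul_self_sqrt (by linarith)).symm h1 h2
        rwa [← Real.sqrt_mul (by linarith), show (s : ℝ) * (K * n * L) = K * s * n * L by ring]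
          at this
    have hlog : 0 ≤ Real.log n := Real.log_nonneg (by linarith)
    have hcompare : ∀ m : ℝ, 0 ≤ m → L ≤ 4 * (m * Real.log n) →
        regret P φ wStar n X A ≤ 16 * C₀ * √(Real.log n) * (1 / 8 * √(m * K * s * n)) := by
      intro m hm hLm
      have h3 : √(K * s * n * L) ≤ 2 * (√(Real.log n) * √(m * K * s * n)) := by
        rw [← Real.sqrt_mul hlog]
        refine Real.sqrt_le_iff.2 ⟨by positivity, ?_⟩
        rw [mul_pow, Real.sq_sqrt (by positivity)]
        calc K * s * n * L ≤ K * s * n * (4 * (m * Real.log n)) :=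
              mul_le_mul_of_nonneg_left hLm (by positivity)
          _ = _ := by ring
      have h4 := mul_le_mul_of_nonneg_left h3 hC₀pos.le
      linarith
    refine ⟨hreg.trans (mul_le_mul_of_nonneg_right (by linarith) (Real.sqrt_nonneg _)),
      fun β hβ => ?_, fun β hβ => ?_⟩
    · have := hcompare 1 zero_le_one (by
        linarith [PolynomialDecay.log_effDim_mul_le hβ (show 1 ≤ n by omega)])
      rwa [one_mul] at this
    · have hm : 0 ≤ max 1 (1 / β) := zero_le_one.trans (le_max_left _ _)
      exact hcompare _ hm (by
        linarith [ExponentialDecay.log_effDim_mul_le hβ hn, mul_nonneg hm hlog])
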